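/- Let $K$ be a field of characteristic zero and let $U_1=\mathrm{Der}\,K[t,t^{-1}]$ be the Lie algebra of derivations of the Laurent polynomial algebra, with the $\mathbb{Z}$-grading $U_1=\bigoplus_{n\in\mathbb{Z}}L_n$, where $L_n$ is the span of $e_n=t^{n+1}\,d/dt$. Let $L\langle X_{\mathbb{Z}}\rangle$ be the free Lie algebra over $K$ on the variables $x_i^g$ ($g\in\mathbb{Z}$, $i=1,2,\ldots$), $\mathbb{Z}$-graded so that $x_i^g$ has degree $g$. A polynomial $f\in L\langle X_{\mathbb{Z}}\rangle$ is a graded identity of $U_1$, written $f\equiv 0$, if $f$ vanishes whenever each variable $x_i^g$ is replaced by an element of $L_g$. A $T_{\mathbb{Z}}$-ideal is an ideal of $L\langle X_{\mathbb{Z}}\rangle$ that is invariant under all degree-preserving Lie endomorphisms of $L\langle X_{\mathbb{Z}}\rangle$, and a set $S$ of graded identities of $U_1$ is a basis of these identities if the smallest $T_{\mathbb{Z}}$-ideal containing $S$ is the set of all graded identities of $U_1$. Write $[u,v,w]=[[u,v],w]$. Then the graded identities $$[x_1^i,x_2^i]\equiv 0\qquad (i\in\mathbb{Z}),$$ $$\alpha\,[x_1^a,x_2^b,x_3^c]-\beta\,[x_1^a,x_3^c,x_2^b]\equiv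 0\qquad (a,b,c\in\mathbb{Z}),$$ where $\alpha=(c-a)(b-c-a)$ and $\beta=(b-a)(c-b-a)$, form a basis of the $\mathbb{Z}$-graded identities of $U_1$ over $K$. -/

import Mathlib

open scoped LaurentPolynomial

/-! ### The Lie algebra `U₁` of derivations of `K[t, t⁻¹]` and its `ℤ`-grading -/

/-- The Lie algebra `U₁ = Der K[t, t⁻¹]`, with the commutator bracket. -/
abbrev U₁ (K : Type*) [Field K] : Type _ :=
  Derivation K K[T;T⁻¹] K[T;T⁻¹]

namespace U₁

/-- The `K`-linear map `d/dt` on `K[t, t⁻¹]`: it sends `tⁿ` to `n tⁿ⁻¹`. -/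
noncomputable def ddtLinear (K : Type*) [Field K] : K[T;T⁻¹] →ₗ[K] K[T;T⁻¹] :=
  (Finsupp.linearCombination K fun n : ℤ => (n : K) • LaurentPolynomial.T (n - 1)) ∘ₗ
    (AddMonoidAlgebra.coeffLinearEquiv K).toLinearMap

theorem ddtLinear_C_mul_T (K : Type*) [Field K] (c : K) (n : ℤ) :
    ddtLinear K (LaurentPolynomial.C c * LaurentPolynomial.T n) =
      LaurentPolynomial.C (c * n) * LaurentPolynomial.T (n - 1) := by
  rw [← LaurentPolynomial.single_eq_C_mul_T, ddtLinear, LinearMap.comp_apply]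
  change Finsupp.linearCombination K _ (Finsupp.single n c) = _
  rw [Finsupp.linearCombination_single, smul_smul, LaurentPolynomial.smul_eq_C_mul]

theorem ddtLinear_leibniz (K : Type*) [Field K] (p q : K[T;T⁻¹]) :
    ddtLinear K (p * q) = p • ddtLinear K q + q • ddtLinear K p := by
  induction p using LaurentPolynomial.induction_on' with
  | add p₁ p₂ h₁ h₂ => simp only [add_mul, map_add, h₁, h₂, smul_add, add_smul]; abel
  | C_mul_T m a =>
    induction q using LaurentPolynomial.induction_on' with
    | add q₁ q₂ h₁ h₂ => simp only [mul_add, map_add, h₁, h₂, smul_add, add_smul]; abel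
    | C_mul_T n b =>
      have e : LaurentPolynomial.C a * LaurentPolynomial.T m *
          (LaurentPolynomial.C b * LaurentPolynomial.T n) =
          LaurentPolynomial.C (a * b) * LaurentPolynomial.T (m + n) := by
        rw [LaurentPolynomial.T_add, map_mul]; ring
      have e₁ : (LaurentPolynomial.T (m + n - 1) : K[T;T⁻¹]) =
          LaurentPolynomial.T m * LaurentPolynomial.T (n - 1) := by
        rw [← LaurentPolynomial.T_add]; congr 1; ring
      have e₂ : (LaurentPolynomial.T n * LaurentPolynomial.T (m - 1) : K[T;T⁻¹]) =
          LaurentPolynomial.T m * LaurentPolynomial.T (n - 1) := by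
        rw [← LaurentPolynomial.T_add, ← LaurentPolynomial.T_add]; congr 1; ring
      rw [e, ddtLinear_C_mul_T, ddtLinear_C_mul_T, ddtLinear_C_mul_T, e₁, smul_eq_mul, smul_eq_mul,
        mul_mul_mul_comm, mul_mul_mul_comm (LaurentPolynomial.C b), e₂]
      simp only [map_mul, Int.cast_add, map_add]
      ring

/-- The derivation `d/dt` of `K[t, t⁻¹]`. -/
noncomputable def ddt (K : Type*) [Field K] : U₁ K :=
  Derivation.mk' (ddtLinear K) (ddtLinear_leibniz K)

/-- The derivation `e_n = t^(n+1) d/dt` of `K[t, t⁻¹]`, for `n ∈ ℤ`. -/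
noncomputable def e (K : Type*) [Field K] (n : ℤ) : U₁ K :=
  (LaurentPolynomial.T (n + 1) : K[T;T⁻¹]) • ddt K

/-- The homogeneous component of degree `n` in the `ℤ`-grading of `U₁`: the span of `e_n`. -/
noncomputable def component (K : Type*) [Field K] (n : ℤ) : Submodule K (U₁ K) :=
  Submodule.span K {e K n}

end U₁

/-! ### Graded polynomials, graded identities and `T_G`-ideals -/

/-- The free `G`-graded Lie algebra `L⟨X_G⟩`: the free Lie algebra on the variables
`x_i^g`, with `g ∈ G` and `i ∈ ℕ`; the variable `x_i^g` is indexed by the pair `(g, i)`. -/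
abbrev FreeGradedLie (K : Type*) [Field K] (G : Type*) : Type _ :=
  FreeLieAlgebra K (G × ℕ)

namespace FreeGradedLie

/-- The variable `x_i^g`. -/
noncomputable def x (K : Type*) [Field K] {G : Type*} (i : ℕ) (g : G) : FreeGradedLie K G :=
  FreeLieAlgebra.of K (g, i)

/-- `IsCommutator g m` says that `m` is a commutator in the variables, with an arbitrary
arrangement of brackets, and that the degrees of the variables in it add up to `g`. -/
inductive IsCommutator {K : Type*} [Field K] {G : Type*} [AddCommGroup G] :
    G → FreeGradedLie K G → Prop
  | var (i : ℕ) (g : G) : IsCommutator g (x K i g)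
  | lie {g h : G} {u v : FreeGradedLie K G} :
      IsCommutator g u → IsCommutator h v → IsCommutator (g + h) ⁅u, v⁆

/-- The homogeneous component of degree `g` of `L⟨X_G⟩`. -/
noncomputable def component (K : Type*) [Field K] {G : Type*} [AddCommGroup G] (g : G) :
    Submodule K (FreeGradedLie K G) :=
  Submodule.span K {m | IsCommutator g m}

/-- An endomorphism of the Lie algebra `L⟨X_G⟩` is graded if it preserves degrees. -/
def IsGradedEnd {K : Type*} [Field K] {G : Type*} [AddCommGroup G]
    (φ : FreeGradedLie K G →ₗ⁅K⁆ FreeGradedLie K G) : Prop :=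
  ∀ g : G, ∀ f ∈ component K g, φ f ∈ component K g

/-- A `T_G`-ideal: a Lie ideal of `L⟨X_G⟩` invariant under all graded endomorphisms. -/
def IsTIdeal {K : Type*} [Field K] {G : Type*} [AddCommGroup G]
    (I : LieIdeal K (FreeGradedLie K G)) : Prop :=
  ∀ φ : FreeGradedLie K G →ₗ⁅K⁆ FreeGradedLie K G, IsGradedEnd φ → ∀ f ∈ I, φ f ∈ I

/-- The `T_G`-ideal `⟨S⟩_G` generated by `S`: the intersection of all `T_G`-ideals containing
`S`. -/
noncomputable def tIdealSpan {K : Type*} [Field K] {G : Type*} [AddCommGroup G]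
    (S : Set (FreeGradedLie K G)) : LieIdeal K (FreeGradedLie K G) :=
  sInf {I | IsTIdeal I ∧ S ⊆ I}

/-- The graded polynomial `f` is a graded identity of the Lie algebra `L` with homogeneous
components `𝒜 g`: it vanishes under every substitution of the variables `x_i^g` by elements of
`𝒜 g`. -/
def IsGradedIdentity {K : Type*} [Field K] {G : Type*} {L : Type*} [LieRing L] [LieAlgebra K L]
    (𝒜 : G → Submodule K L) (f : FreeGradedLie K G) : Prop :=
  ∀ a : G × ℕ → L, (∀ g i, a (g, i) ∈ 𝒜 g) → FreeLieAlgebra.lift K a f = 0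

/-- `S` is a basis of the graded identities of `L`: the `T_G`-ideal generated by `S` consists
exactly of the graded identities of `L`. -/
def IsBasisOfGradedIdentities {K : Type*} [Field K] {G : Type*} [AddCommGroup G] {L : Type*}
    [LieRing L] [LieAlgebra K L] (𝒜 : G → Submodule K L) (S : Set (FreeGradedLie K G)) : Prop :=
  ∀ f : FreeGradedLie K G, f ∈ tIdealSpan S ↔ IsGradedIdentity 𝒜 f

end FreeGradedLie

/-! ### Degrees of a multiset and the numerical obstruction -/

section DegreeMultisets

variable {X : Type*} {deg : X → ℤ}

/-! On homogeneous elements of the quotient by the ideal generated by the basic identities, put `u *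
v = [u, v] / (deg v - deg u)`. This product is commutative. Since `[[u, v], w]` is `β` times `(u *
v) * w`, the second identity becomes `(u * v) * w = (u * w) * v` wherever its coefficient `αβ` is
nonzero; the first identity kills brackets of equal degrees.

The core is combinatorial: all products of a given multiset that multiply only elements of distinct
degrees agree (`Contracts.unique`). An admissible product of at least two elements exists exactly
when the degrees are not `Degenerate` (`Contracts.not_degenerate`, `exists_contracts`). Uniqueness
goes by induction on the number of factors. Let `i` have largest absolute degree. By
`Contracts.exists_partner` the two products may be assumed to begin with `i * j` and `i * k`; they
are then joined by a chain of products in which neighbours share a first multiplication, so the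
induction hypothesis applies to each link. Nondegeneracy supplies the intermediate products.

Consequently every commutator in the variables `m` maps to `c • N m`, where `c` is its coefficient
in `U₁` and `N m` depends only on `m`. Thus the image of `f` depends linearly on the polynomial
giving its values at `x_i^g ↦ r • e_g`. If `f` is a graded identity, this polynomial vanishes on the
infinite field `K`, hence is zero, and `f` lies in the ideal. The converse is a direct computation
with `[e_a, e_b] = (b - a) e_{a+b}`. -/

theorem Int.eq_of_dvd_of_pos_of_le {g x : ℤ} (h : g ∣ x) (h₀ : 0 < x) (h₁ : x ≤ g) : x = g :=
  le_antisymm h₁ (Int.le_of_dvd h₀ h)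

theorem Int.eq_zero_of_dvd_of_lt {g x : ℤ} (h : g ∣ x) (h₀ : -g < x) (h₁ : x < g) : x = 0 :=
  Int.eq_zero_of_abs_lt_dvd h (abs_lt.2 ⟨h₀, h₁⟩)

/-- A multiple of `g` not exceeding `g` is `g` itself or nonpositive, and two distinct ones cannot
both be `g`. So an admissible multiplication preserves the bound by `g`. -/
theorem Int.add_le_of_dvd_of_le {g x y : ℤ} (hx : g ∣ x) (hy : g ∣ y) (hxg : x ≤ g)
    (hyg : y ≤ g) (hg : 0 ≤ g) (h : x ≠ y) : 0 < g ∧ x + y ≤ g := by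
  rcases hg.eq_or_lt with rfl | hg
  · rw [zero_dvd_iff] at hx hy; exact absurd (hx.trans hy.symm) h
  refine ⟨hg, ?_⟩
  have aux : ∀ z, g ∣ z → z ≤ g → z = g ∨ z ≤ 0 := fun z h1 h2 => by
    by_cases hz : 0 < z
    · exact .inl (Int.eq_of_dvd_of_pos_of_le h1 hz h2)
    · exact .inr (by omega)
  rcases aux x hx hxg with h1 | h1 <;> rcases aux y hy hyg with h2 | h2 <;> omega

theorem exists_cons_of_sum_pos {m : Multiset X} {g : ℤ}
    (hm : ∀ x ∈ m, g ∣ deg x ∧ deg x ≤ g) (hs : 0 < (m.map deg).sum) :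
    ∃ x m', m = x ::ₘ m' ∧ deg x = g := by
  by_contra! hc
  have : (m.map deg).sum ≤ (m.map fun _ => (0 : ℤ)).sum := by
    refine Multiset.sum_map_le_sum_map _ _ fun x hx => ?_
    by_contra! h0
    obtain ⟨m', rfl⟩ := Multiset.exists_cons_of_mem hx
    exact hc x m' rfl (Int.eq_of_dvd_of_pos_of_le (hm x hx).1 h0 (hm x hx).2)
  simp at this; omega

theorem exists_cons_of_sum_neg {m : Multiset X} {g : ℤ}
    (hm : ∀ x ∈ m, g ∣ deg x ∧ -g ≤ deg x) (hs : (m.map deg).sum < 0) :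
    ∃ x m', m = x ::ₘ m' ∧ deg x = -g := by
  obtain ⟨x, m', h, hx⟩ := exists_cons_of_sum_pos (deg := fun x => -deg x) (m := m) (g := g)
    (fun x h => ⟨(hm x h).1.neg_right, by linarith [(hm x h).2]⟩)
    (by rw [Multiset.sum_map_neg]; omega)
  exact ⟨x, m', h, by omega⟩

/-- The numerical obstruction to the existence of products of the elements of `m`. -/
def Degenerate (deg : X → ℤ) (m : Multiset X) : Prop :=
  (∃ g, 0 ≤ g ∧ (∀ x ∈ m, g ∣ deg x ∧ deg x ≤ g) ∧ 2 * g ≤ (m.map deg).sum) ∨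
  (∃ g, 0 ≤ g ∧ (∀ x ∈ m, g ∣ deg x ∧ -g ≤ deg x) ∧ (m.map deg).sum ≤ -(2 * g))

theorem Degenerate.neg {m : Multiset X} (h : Degenerate deg m) :
    Degenerate (fun x => -deg x) m := by
  rcases h with ⟨g, hg, hm, hs⟩ | ⟨g, hg, hm, hs⟩
  · refine .inr ⟨g, hg, fun x hx => ?_, ?_⟩
    · have := hm x hx; exact ⟨this.1.neg_right, by linarith [this.2]⟩
    · rw [Multiset.sum_map_neg]; linarith
  · refine .inl ⟨g, hg, fun x hx => ?_, ?_⟩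
    · have := hm x hx; exact ⟨this.1.neg_right, by linarith [this.2]⟩
    · rw [Multiset.sum_map_neg]; linarith

theorem degenerate_neg {m : Multiset X} :
    Degenerate (fun x => -deg x) m ↔ Degenerate deg m :=
  ⟨fun h => by simpa using h.neg, Degenerate.neg⟩

/-- A positive sum excludes the negative obstruction, and `g = 0` as well, since that forces every
degree to vanish. -/
theorem not_degenerate_of_sum_pos {m : Multiset X} (hs : 0 < (m.map deg).sum)
    (h : ∀ g, 0 < g → (∀ x ∈ m, g ∣ deg x ∧ deg x ≤ g) → 2 * g ≤ (m.map deg).sum → False) :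
    ¬ Degenerate deg m := by
  rintro (⟨g, hg, hx, hg'⟩ | ⟨g, hg, hx, hg'⟩)
  · rcases hg.eq_or_lt with rfl | h0
    · have : (m.map deg).sum = 0 := Multiset.sum_eq_zero fun y hy => by
        obtain ⟨x, hx', rfl⟩ := Multiset.mem_map.1 hy
        exact zero_dvd_iff.1 (hx x hx').1
      omega
    · exact h g h0 hx hg'
  · omega

theorem not_degenerate_of_sum_neg {m : Multiset X} (hs : (m.map deg).sum < 0)
    (h : ∀ g, 0 < g → (∀ x ∈ m, g ∣ deg x ∧ -g ≤ deg x) → (m.map deg).sum ≤ -(2 * g) → False) :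
    ¬ Degenerate deg m := by
  rintro (⟨g, hg, hx, hg'⟩ | ⟨g, hg, hx, hg'⟩)
  · omega
  · rcases hg.eq_or_lt with rfl | h0
    · have : (m.map deg).sum = 0 := Multiset.sum_eq_zero fun y hy => by
        obtain ⟨x, hx', rfl⟩ := Multiset.mem_map.1 hy
        exact zero_dvd_iff.1 (hx x hx').1
      omega
    · exact h g h0 hx hg'

theorem not_degenerate_of_sum_eq_zero {m : Multiset X} (hs : (m.map deg).sum = 0)
    {x : X} (hx : x ∈ m) (h : deg x ≠ 0) : ¬ Degenerate deg m := by
  rintro (⟨g, hg, hm, hg'⟩ | ⟨g, hg, hm, hg'⟩)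
  all_goals
    obtain rfl : g = 0 := by omega
    exact h (zero_dvd_iff.1 (hm x hx).1)

theorem exists_max_abs_deg {m : Multiset X} (hm : m ≠ 0) :
    ∃ i m₁, m = i ::ₘ m₁ ∧ ∀ x ∈ m, |deg x| ≤ |deg i| := by
  obtain ⟨i, hi, h⟩ := Multiset.exists_max_image (fun x => |deg x|) hm
  obtain ⟨m₁, rfl⟩ := Multiset.exists_cons_of_mem hi
  exact ⟨i, m₁, rfl, h⟩

theorem degenerate_of_forall_deg_eq_zero {m : Multiset X} (h : ∀ x ∈ m, deg x = 0) :
    Degenerate deg m :=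
  .inl ⟨0, le_rfl, fun x hx => by simp [h x hx], by
    rw [Multiset.sum_eq_zero]
    · simp
    · intro y hy
      obtain ⟨x, hx', rfl⟩ := Multiset.mem_map.1 hy
      exact h x hx'⟩

theorem sum_map_nonneg {m : Multiset X} (h : ∀ x ∈ m, 0 ≤ deg x) : 0 ≤ (m.map deg).sum := by
  refine Multiset.sum_nonneg fun y hy => ?_
  obtain ⟨x, hx, rfl⟩ := Multiset.mem_map.1 hy
  exact h x hx

end DegreeMultisets

/-! ### Admissible products in a commutative magma: existence -/

section SwappableMagma

variable {X : Type*} [CommMagma X] {deg : X → ℤ}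

/-- A degree function on a commutative magma, additive on products, such that two factors may be
swapped whenever the degrees in all the products involved are distinct. -/
structure IsSwappable (deg : X → ℤ) : Prop where
  deg_mul : ∀ x y, deg (x * y) = deg x + deg y
  swap : ∀ x y z, deg x ≠ deg y → deg x + deg y ≠ deg z → deg x ≠ deg z →
    deg x + deg z ≠ deg y → x * y * z = x * z * y

/-- `Contracts deg m u`: the element `u` is a product, in some arrangement, of the elements of `m`,
where only elements of distinct degrees are multiplied. -/
inductive Contracts (deg : X → ℤ) : Multiset X → X → Prop
  | single (x : X) : Contracts deg {x} x
  | mul {x y : X} {m : Multiset X} {u : X} : deg x ≠ deg y →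
      Contracts deg (x * y ::ₘ m) u → Contracts deg (x ::ₘ y ::ₘ m) u

/-- Changing the sign of all degrees lets the element of largest absolute degree be assumed of
positive degree. -/
theorem IsSwappable.neg (h : IsSwappable deg) : IsSwappable (fun x => -deg x) where
  deg_mul x y := by rw [h.deg_mul]; ring
  swap x y z h₁ h₂ h₃ h₄ := h.swap x y z (by grind) (by grind) (by grind) (by grind)

theorem Contracts.neg {m : Multiset X} {u : X} (h : Contracts deg m u) :
    Contracts (fun x => -deg x) m u := by
  induction h with
  | single x => exact .single x
  | mul hxy _ ih => exact .mul (by grind) ih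

theorem contracts_neg {m : Multiset X} {u : X} :
    Contracts (fun x => -deg x) m u ↔ Contracts deg m u :=
  ⟨fun h => by simpa using h.neg, Contracts.neg⟩

theorem Contracts.ne_zero {m : Multiset X} {u : X} (h : Contracts deg m u) : m ≠ 0 := by
  cases h <;> simp

theorem Contracts.deg_eq (hd : IsSwappable deg) {m : Multiset X} {u : X}
    (h : Contracts deg m u) : deg u = (m.map deg).sum := by
  induction h with
  | single x => simp
  | mul _ _ ih => rw [ih]; simp [hd.deg_mul]; ring

theorem Contracts.add {m₁ m₂ : Multiset X} {u w : X} (h : Contracts deg m₁ u)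
    (hw : Contracts deg (u ::ₘ m₂) w) : Contracts deg (m₁ + m₂) w := by
  induction h with
  | single x => simpa using hw
  | mul hxy _ ih =>
    have := ih hw
    simp only [Multiset.cons_add] at this ⊢
    exact .mul hxy this

theorem Contracts.mul_add {m₁ m₂ : Multiset X} {u v : X} (h₁ : Contracts deg m₁ u)
    (h₂ : Contracts deg m₂ v) (huv : deg u ≠ deg v) : Contracts deg (m₁ + m₂) (u * v) := by
  refine h₁.add ?_
  have : Contracts deg (m₂ + {u}) (u * v) := by
    refine h₂.add ?_
    have : Contracts deg (u ::ₘ v ::ₘ 0) (u * v) := .mul huv (.single _)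
    rw [Multiset.cons_swap] at this
    exact this
  rwa [add_comm, Multiset.singleton_add] at this

theorem Contracts.eq_of_single {x u : X} (h : Contracts deg {x} u) : u = x := by
  generalize hm : ({x} : Multiset X) = m at h
  cases h with
  | single y => exact (Multiset.singleton_inj.1 hm).symm
  | mul _ _ => have := congrArg Multiset.card hm; simp at this

/-- Any factor can be chosen to take part in the first multiplication. -/
theorem Contracts.exists_partner (hd : IsSwappable deg) {m : Multiset X} {u : X}
    (h : Contracts deg m u) : ∀ {i : X} {m₁ : Multiset X}, m = i ::ₘ m₁ → m₁ ≠ 0 →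
      ∃ j m₂, m₁ = j ::ₘ m₂ ∧ deg i ≠ deg j ∧ Contracts deg (i * j ::ₘ m₂) u := by
  induction h with
  | single x =>
    intro i m₁ hm h0
    have := congrArg Multiset.card hm
    simp at this
    exact absurd this h0
  | @mul x y m u hxy h ih =>
    intro i m₁ hm h0
    rcases Multiset.cons_eq_cons.1 hm with ⟨rfl, rfl⟩ | ⟨-, cs, hcs, rfl⟩
    · exact ⟨y, m, rfl, hxy, h⟩
    rcases Multiset.cons_eq_cons.1 hcs with ⟨rfl, rfl⟩ | ⟨-, ds, rfl, rfl⟩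
    · exact ⟨x, m, rfl, hxy.symm, by rwa [mul_comm]⟩
    obtain ⟨j, m₂, hj, hij, hc⟩ := ih (i := i) (m₁ := x * y ::ₘ ds)
      (Multiset.cons_swap _ _ _) (by simp)
    rcases Multiset.cons_eq_cons.1 hj with ⟨rfl, rfl⟩ | ⟨-, es, rfl, rfl⟩
    · rw [hd.deg_mul] at hij
      -- The factor `i` meets `x * y`. At least one of `(x * i) * y` and `(y * i) * x` is
      -- admissible: if both failed, then `deg x = deg y` or `deg i = deg x + deg y`.
      by_cases h₁ : deg x ≠ deg i ∧ deg x + deg i ≠ deg y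
      · refine ⟨x, y ::ₘ ds, rfl, h₁.1.symm, .mul (by rw [hd.deg_mul, add_comm]; exact h₁.2) ?_⟩
        rw [mul_comm i x, ← hd.swap x y i hxy (by grind) h₁.1 h₁.2, mul_comm _ i]
        exact hc
      · have h₂ : deg y ≠ deg i ∧ deg y + deg i ≠ deg x := by grind
        refine ⟨y, x ::ₘ ds, Multiset.cons_swap _ _ _, h₂.1.symm,
          .mul (by rw [hd.deg_mul, add_comm]; exact h₂.2) ?_⟩
        rw [mul_comm i y, ← hd.swap y x i hxy.symm (by grind) h₂.1 h₂.2, mul_comm _ i,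
          mul_comm y x]
        exact hc
    · refine ⟨j, x ::ₘ y ::ₘ es, ?_, hij, ?_⟩
      · rw [Multiset.cons_swap y j, Multiset.cons_swap x j]
      · rw [Multiset.cons_swap _ x, Multiset.cons_swap _ y]
        refine .mul hxy ?_
        rwa [Multiset.cons_swap]

theorem Contracts.ne_of_pair (hd : IsSwappable deg) {x y u : X}
    (h : Contracts deg (x ::ₘ y ::ₘ 0) u) : deg x ≠ deg y := by
  obtain ⟨j, m₂, hj, hij, -⟩ := h.exists_partner hd rfl (by simp)
  have : y = j := by
    rcases Multiset.cons_eq_cons.1 hj with ⟨h, -⟩ | ⟨-, cs, h, -⟩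
    · exact h
    · simp at h
  rwa [this]

/-- Each admissible multiplication keeps all degrees multiples of `g` bounded by `g`. The last one
multiplies two elements, so the total is at most `g`, with `g > 0`. -/
theorem Contracts.sum_lt (hd : IsSwappable deg) {m : Multiset X} {u : X} (h : Contracts deg m u)
    {g : ℤ} (hg : 0 ≤ g) :
    (∀ x ∈ m, g ∣ deg x ∧ deg x ≤ g) → 2 ≤ Multiset.card m → (m.map deg).sum < 2 * g := by
  induction h with
  | single x => intro _ h; simp at h
  | @mul x y m u hxy h ih =>
    intro hm _
    simp only [Multiset.mem_cons, forall_eq_or_imp] at hm ih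
    have key := Int.add_le_of_dvd_of_le hm.1.1 hm.2.1.1 hm.1.2 hm.2.1.2 hg hxy
    rw [hd.deg_mul] at ih
    have ih := ih ⟨⟨dvd_add hm.1.1 hm.2.1.1, key.2⟩, hm.2.2⟩
    simp only [Multiset.map_cons, Multiset.sum_cons, hd.deg_mul, Multiset.card_cons] at ih ⊢
    rcases Nat.eq_zero_or_pos (Multiset.card m) with h0 | h0
    · rw [Multiset.card_eq_zero] at h0
      subst h0
      simp; omega
    · have := ih (by omega); omega

theorem Contracts.not_degenerate (hd : IsSwappable deg) {m : Multiset X} {u : X}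
    (h : Contracts deg m u) (hm : 2 ≤ Multiset.card m) : ¬ Degenerate deg m := by
  rintro (⟨g, hg, hx, hs⟩ | ⟨g, hg, hx, hs⟩)
  · have := h.sum_lt hd hg hx hm; omega
  · have := h.neg.sum_lt hd.neg hg
      (fun x h => ⟨(hx x h).1.neg_right, by linarith [(hx x h).2]⟩) hm
    rw [Multiset.sum_map_neg] at this; omega

/-- A nondegenerate multiset stays nondegenerate after a suitable multiplication by an element of
largest absolute degree. -/
theorem exists_partner_of_not_degenerate (hd : IsSwappable deg) {i : X} {m : Multiset X}
    (hi : 0 < deg i) (hm : ∀ x ∈ m, -deg i ≤ deg x ∧ deg x ≤ deg i) (h0 : m ≠ 0)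
    (h : ¬ Degenerate deg (i ::ₘ m)) :
    ∃ j m', m = j ::ₘ m' ∧ deg i ≠ deg j ∧ (m' = 0 ∨ ¬ Degenerate deg (i * j ::ₘ m')) := by
  have hj : ∃ j ∈ m, deg i ≠ deg j := by
    by_contra! hc
    obtain ⟨x, hx⟩ := Multiset.exists_mem_of_ne_zero h0
    obtain ⟨m', rfl⟩ := Multiset.exists_cons_of_mem hx
    -- If all degrees equal `deg i`, then `g = deg i` is an obstruction.
    refine h (.inl ⟨deg i, hi.le, ?_, ?_⟩)
    · intro y hy
      rcases Multiset.mem_cons.1 hy with rfl | hy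
      · simp
      · rw [hc y hy]; simp
    · have : (m'.map fun _ => (0 : ℤ)).sum ≤ (m'.map deg).sum :=
        Multiset.sum_map_le_sum_map _ _ fun y hy => by
          rw [← hc y (Multiset.mem_cons_of_mem hy)]; exact hi.le
      simp at this
      simp [← hc x]; linarith
  obtain ⟨j, hj, hij⟩ := hj
  obtain ⟨m, rfl⟩ := Multiset.exists_cons_of_mem hj
  by_cases hD : m = 0 ∨ ¬ Degenerate deg (i * j ::ₘ m)
  · exact ⟨j, m, rfl, hij, hD⟩
  push Not at hD
  -- When `i * j` produces an obstruction `g`, the partner `j` is replaced by an `l` of degree `g`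
  -- or `-g` among the remaining elements.
  have swap : ∀ l m', m = l ::ₘ m' → deg i ≠ deg l → ¬ Degenerate deg (i * l ::ₘ j ::ₘ m') →
      ∃ j' m', j ::ₘ m = j' ::ₘ m' ∧ deg i ≠ deg j' ∧
        (m' = 0 ∨ ¬ Degenerate deg (i * j' ::ₘ m')) := by
    rintro l m' rfl hil hD
    exact ⟨l, j ::ₘ m', Multiset.cons_swap _ _ _, hil, .inr hD⟩
  have zero : deg i + deg j = 0 → (∀ x ∈ m, deg x = 0) → ∃ j' m', j ::ₘ m = j' ::ₘ m' ∧
      deg i ≠ deg j' ∧ (m' = 0 ∨ ¬ Degenerate deg (i * j' ::ₘ m')) := by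
    intro hj0 hm0
    obtain ⟨l, hl⟩ := Multiset.exists_mem_of_ne_zero hD.1
    obtain ⟨m', rfl⟩ := Multiset.exists_cons_of_mem hl
    have hl0 := hm0 l hl
    have hs : (m'.map deg).sum = 0 := Multiset.sum_eq_zero fun y hy => by
      obtain ⟨x, hx', rfl⟩ := Multiset.mem_map.1 hy
      exact hm0 x (Multiset.mem_cons_of_mem hx')
    refine swap l m' rfl (by omega) (not_degenerate_of_sum_eq_zero (x := i * l) ?_ (by simp) ?_)
    · simp [hd.deg_mul]; omega
    · rw [hd.deg_mul]; omega
  have hbj := hm j (by simp)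
  rcases hD.2 with ⟨g, hg, hx, hs⟩ | ⟨g, hg, hx, hs⟩
  · simp only [Multiset.mem_cons, forall_eq_or_imp, hd.deg_mul, Multiset.map_cons,
      Multiset.sum_cons] at hx hs hm
    obtain ⟨⟨hgi, hgi'⟩, hx⟩ := hx
    rcases hg.eq_or_lt with rfl | hg
    · exact zero (zero_dvd_iff.1 hgi) fun x hxm => zero_dvd_iff.1 (hx x hxm).1
    obtain ⟨l, m', rfl, hl⟩ := exists_cons_of_sum_pos hx (by omega)
    simp only [Multiset.mem_cons, forall_eq_or_imp, Multiset.map_cons,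
      Multiset.sum_cons] at hx hs hm
    -- If `g = deg i`, it obstructs the original multiset. Otherwise a new obstruction `g'` is at
    -- least `deg i + deg l > deg i`; this forces `deg j = 0` and then an element of degree `g'`,
    -- too large.
    rcases hm.2.1.2.eq_or_lt with hgM | hgM
    · refine absurd (.inl ⟨g, hg.le, ?_, ?_⟩) h
      · simp only [Multiset.mem_cons, forall_eq_or_imp]
        have : g ∣ deg i := by rw [← hgM, hl]
        exact ⟨⟨this, by omega⟩, ⟨(dvd_add_right this).1 hgi, by omega⟩, hx⟩
      · simp; omega
    · refine swap l m' rfl (by omega) (not_degenerate_of_sum_pos ?_ ?_)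
      · simp [hd.deg_mul]; omega
      · intro g' hg' hx' hs'
        simp only [Multiset.mem_cons, forall_eq_or_imp, hd.deg_mul, Multiset.map_cons,
          Multiset.sum_cons] at hx' hs'
        have h1 := Int.eq_zero_of_dvd_of_lt hx'.2.1.1 (by omega) (by omega)
        obtain ⟨x, m'', rfl, hx2⟩ := exists_cons_of_sum_pos hx'.2.2 (by omega)
        have := hm.2.2 x (by simp)
        omega
  · simp only [Multiset.mem_cons, forall_eq_or_imp, hd.deg_mul, Multiset.map_cons,
      Multiset.sum_cons] at hx hs hm
    obtain ⟨⟨hgi, hgi'⟩, hx⟩ := hx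
    rcases hg.eq_or_lt with rfl | hg
    · exact zero (zero_dvd_iff.1 hgi) fun x hxm => zero_dvd_iff.1 (hx x hxm).1
    obtain ⟨l, m', rfl, hl⟩ := exists_cons_of_sum_neg hx (by omega)
    simp only [Multiset.mem_cons, forall_eq_or_imp, Multiset.map_cons,
      Multiset.sum_cons] at hx hs hm
    -- A second element of degree `-g` remains after `l` is used; it forces any new obstruction to
    -- equal `g`, which then obstructs the original multiset.
    obtain ⟨x, m'', rfl, hx2⟩ := exists_cons_of_sum_neg hx.2 (by omega)
    refine swap l _ rfl (by omega) (not_degenerate_of_sum_neg ?_ ?_)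
    · simp [hd.deg_mul] at hs ⊢; omega
    · intro g' hg' hx' hs'
      simp only [Multiset.mem_cons, forall_eq_or_imp, hd.deg_mul, Multiset.map_cons,
          Multiset.sum_cons] at hx' hs' hx hs hm
      obtain ⟨⟨h1, h1'⟩, ⟨h2, h2'⟩, ⟨h3, h3'⟩, h4⟩ := hx'
      obtain rfl : g' = g := by
        have := Int.eq_of_dvd_of_pos_of_le h3.neg_right (by omega) (by omega)
        omega
      refine h (.inr ⟨g', hg.le, ?_, ?_⟩)
      · simp only [Multiset.mem_cons, forall_eq_or_imp]
        exact ⟨⟨(dvd_add_left hx.1.1).1 h1, by omega⟩, ⟨h2, h2'⟩, hx⟩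
      · simp; omega

/-- Multiplying an element of largest absolute degree by a suitable partner keeps the multiset
nondegenerate, so induction on its size applies. If all degrees vanish, `g = 0` is an obstruction.
-/
theorem exists_contracts (hd : IsSwappable deg) {m : Multiset X} (h0 : m ≠ 0)
    (h : ¬ Degenerate deg m) : ∃ u, Contracts deg m u := by
  induction hn : Multiset.card m generalizing m deg with
  | zero => exact absurd (Multiset.card_eq_zero.1 hn) h0
  | succ n ih =>
    obtain ⟨i, m, rfl, hi⟩ := exists_max_abs_deg (deg := deg) h0
    by_cases hm0 : m = 0
    · subst hm0; exact ⟨i, .single i⟩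
    have main : ∀ {deg : X → ℤ}, IsSwappable deg → ¬ Degenerate deg (i ::ₘ m) → 0 < deg i →
        (∀ x ∈ i ::ₘ m, |deg x| ≤ |deg i|) → ∃ u, Contracts deg (i ::ₘ m) u := by
      intro deg hd h hpos hi
      rw [abs_of_pos hpos] at hi
      obtain ⟨j, m', rfl, hij, hm'⟩ := exists_partner_of_not_degenerate hd hpos
        (fun x hx => abs_le.1 (hi x (Multiset.mem_cons_of_mem hx))) hm0 h
      rcases hm' with rfl | hm'
      · exact ⟨i * j, .mul hij (.single _)⟩
      · obtain ⟨u, hu⟩ := ih hd (by simp) hm' (by simpa using hn)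
        exact ⟨u, .mul hij hu⟩
    rcases lt_trichotomy (deg i) 0 with hneg | hzero | hpos
    · obtain ⟨u, hu⟩ := main hd.neg (by rwa [degenerate_neg]) (by simpa using hneg)
        (by simpa using hi)
      exact ⟨u, contracts_neg.1 hu⟩
    · refine absurd (degenerate_of_forall_deg_eq_zero fun x hx => ?_) h
      simpa [hzero] using hi x hx
    · exact main hd h hpos hi

/-! ### Admissible products in a commutative magma: uniqueness -/

/-- All products of `n` elements agree. -/
def UniqueProducts (deg : X → ℤ) (n : ℕ) : Prop :=
  ∀ m u u', Multiset.card m = n → Contracts deg m u → Contracts deg m u' → u = u'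

theorem UniqueProducts.neg {n : ℕ} (h : UniqueProducts deg n) :
    UniqueProducts (fun x => -deg x) n :=
  fun m u u' hm hu hu' => h m u u' hm (contracts_neg.1 hu) (contracts_neg.1 hu')

theorem Contracts.cons_swap {x y : X} {m : Multiset X} {u : X}
    (h : Contracts deg (x ::ₘ y ::ₘ m) u) : Contracts deg (y ::ₘ x ::ₘ m) u := by
  rwa [Multiset.cons_swap]

/-- The common product `w` through `i * j * k = i * k * j` shares its first multiplication with each
side. -/
theorem UniqueProducts.eq_of_swap (hd : IsSwappable deg) {i j k u u' w : X} {R : Multiset X}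
    (hU : UniqueProducts deg (Multiset.card R + 2))
    (hu : Contracts deg (i * j ::ₘ k ::ₘ R) u) (hu' : Contracts deg (i * k ::ₘ j ::ₘ R) u')
    (hij : deg i ≠ deg j) (hik : deg i ≠ deg k) (hijk : deg i + deg j ≠ deg k)
    (hikj : deg i + deg k ≠ deg j) (hw : Contracts deg (i * j * k ::ₘ R) w) : u = u' := by
  have h₁ : Contracts deg (i * j ::ₘ k ::ₘ R) w := .mul (by rwa [hd.deg_mul]) hw
  rw [hd.swap i j k hij hijk hik hikj] at hw
  have h₂ : Contracts deg (i * k ::ₘ j ::ₘ R) w := .mul (by rwa [hd.deg_mul]) hw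
  exact (hU _ _ _ (by simp) hu h₁).trans (hU _ _ _ (by simp) h₂ hu')

/-- The multiplications `i * j` and `k * l` involve different factors, so a product performing both
can be read as beginning with either. -/
theorem UniqueProducts.eq_of_disjoint (hd : IsSwappable deg) {i j k l u u' : X} {R : Multiset X}
    (hU : UniqueProducts deg (Multiset.card R + 3))
    (hu : Contracts deg (i * j ::ₘ k ::ₘ l ::ₘ R) u)
    (hu' : Contracts deg (k * l ::ₘ i ::ₘ j ::ₘ R) u')
    (hij : deg i ≠ deg j) (hkl : deg k ≠ deg l)
    (h : ¬ Degenerate deg (i * j ::ₘ k * l ::ₘ R)) : u = u' := by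
  obtain ⟨w, hw⟩ := exists_contracts hd (by simp) h
  have h₁ : Contracts deg (i * j ::ₘ k ::ₘ l ::ₘ R) w := by
    have := Contracts.mul hkl hw.cons_swap
    rwa [Multiset.cons_swap l, Multiset.cons_swap k] at this
  have h₂ : Contracts deg (k * l ::ₘ i ::ₘ j ::ₘ R) w := by
    have := Contracts.mul hij hw
    rwa [Multiset.cons_swap j, Multiset.cons_swap i] at this
  exact (hU _ _ _ (by simp) hu h₁).trans (hU _ _ _ (by simp) h₂ hu')

/-- Since `deg k = deg (i * j)`, the direct swap of `j` and `k` is unavailable. A third factor `l`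
helps: both sides are compared with products beginning with `i * l`. -/
theorem UniqueProducts.eq_of_third (hd : IsSwappable deg) {i j k l u u' : X} {R : Multiset X}
    (hi : 0 < deg i) (hj : deg j < 0) (hk : deg k = deg i + deg j)
    (hl : -deg i ≤ deg l ∧ deg l ≤ deg i) (hil : deg i ≠ deg l) (hkl : deg k ≠ deg l)
    (hU : UniqueProducts deg (Multiset.card R + 3))
    (hu : Contracts deg (i * j ::ₘ k ::ₘ l ::ₘ R) u)
    (hu' : Contracts deg (i * k ::ₘ j ::ₘ l ::ₘ R) u') (hk0 : 0 ≤ deg k)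
    (h₁ : ¬ Degenerate deg (i * j * l ::ₘ k ::ₘ R))
    (h₂ : ¬ Degenerate deg (i * k * l ::ₘ j ::ₘ R)) : u = u' := by
  obtain ⟨w', hw'⟩ := exists_contracts hd (by simp) h₂
  have hu'w' : u' = w' := by
    refine hU _ _ _ (by simp) hu' ?_
    rw [Multiset.cons_swap]
    have := Contracts.mul (deg := deg) (x := i * k) (y := l)
      (by rw [hd.deg_mul]; omega) hw'
    rwa [Multiset.cons_swap l, Multiset.cons_swap (i * k)] at this
  -- Here `deg (i * l) = deg k`, so `i * l` cannot be multiplied by `k`; the disjoint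
  -- multiplications `i * j` and `k * l` are used instead.
  by_cases hjl : deg j = deg l
  · have h₁' : ¬ Degenerate deg (i * j ::ₘ k * l ::ₘ R) := by
      intro h
      apply h₁
      rcases h with ⟨g, hg, hx, hs⟩ | ⟨g, hg, hx, hs⟩
      · refine .inl ⟨g, hg, ?_, ?_⟩
        · simp only [Multiset.mem_cons, forall_eq_or_imp, hd.deg_mul, ← hk] at hx ⊢
          exact ⟨hx.2.1, hx.1, hx.2.2⟩
        · simp only [Multiset.map_cons, Multiset.sum_cons, hd.deg_mul] at hs ⊢
          omega
      · refine .inr ⟨g, hg, ?_, ?_⟩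
        · simp only [Multiset.mem_cons, forall_eq_or_imp, hd.deg_mul, ← hk] at hx ⊢
          exact ⟨hx.2.1, hx.1, hx.2.2⟩
        · simp only [Multiset.map_cons, Multiset.sum_cons, hd.deg_mul] at hs ⊢
          omega
    refine hU.eq_of_disjoint hd hu (u' := u') ?_ (by omega) hkl h₁'
    subst hu'w'
    refine .mul (by rw [hd.deg_mul]; omega) ?_
    have := hd.swap k i l (by omega) (by omega) (by omega) (by omega)
    rwa [← this, mul_comm k i]
  · obtain ⟨w, hw⟩ := exists_contracts hd (by simp) h₁
    have huw : u = w := by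
      refine hU _ _ _ (by simp) hu ?_
      have := Contracts.mul (deg := deg) (x := i * j) (y := l)
        (by rw [hd.deg_mul]; omega) hw
      rwa [Multiset.cons_swap l] at this
    subst huw hu'w'
    rw [hd.swap i j l (by omega) (by omega) (by omega) (by omega)] at hw
    rw [hd.swap i k l (by omega) (by omega) (by omega) (by omega)] at hw'
    have a₁ : Contracts deg (i * l ::ₘ j ::ₘ k ::ₘ R) u :=
      .mul (by rw [hd.deg_mul]; omega) hw
    have a₂ : Contracts deg (i * l ::ₘ k ::ₘ j ::ₘ R) u' :=
      .mul (by rw [hd.deg_mul]; omega) hw'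
    rw [Multiset.cons_swap k] at a₂
    exact hU _ _ _ (by simp) a₁ a₂

theorem UniqueProducts.eq_of_deg_eq_add_of_exists (hd : IsSwappable deg) {i j k l u u' : X}
    {R : Multiset X} (hi : 0 < deg i) (hj : deg j < 0) (hji : -deg i ≤ deg j)
    (hk : deg k = deg i + deg j)
    (hR : ∀ x ∈ l ::ₘ R, -deg i ≤ deg x ∧ deg x ≤ deg i)
    (hil : deg i ≠ deg l) (hkl : deg k ≠ deg l)
    (hU : UniqueProducts deg (Multiset.card R + 3))
    (hu : Contracts deg (i * j ::ₘ k ::ₘ l ::ₘ R) u)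
    (hu' : Contracts deg (i * k ::ₘ j ::ₘ l ::ₘ R) u') : u = u' := by
  have hk0 : 0 ≤ deg k := by omega
  have nz := hu.not_degenerate hd (by simp)
  have nz' := hu'.not_degenerate hd (by simp)
  simp only [Multiset.mem_cons, forall_eq_or_imp] at hR
  -- multiplication by an element other than `l`
  have alt : ∀ l' R', R = l' ::ₘ R' → deg i ≠ deg l' → deg k ≠ deg l' →
      ¬ Degenerate deg (i * j * l' ::ₘ k ::ₘ l ::ₘ R') →
      ¬ Degenerate deg (i * k * l' ::ₘ j ::ₘ l ::ₘ R') → u = u' := by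
    rintro l' R' rfl h1 h2 h3 h4
    rw [Multiset.cons_swap l] at hu hu'
    exact UniqueProducts.eq_of_third hd hi hj hk (hR.2 l' (by simp)) h1 h2 (by simpa using hU)
      hu hu' hk0 h3 h4
  have sat : ∀ g, 0 ≤ g → g ∣ deg k → deg k ≤ g → g ∣ deg l → deg l ≤ g →
      (∀ x ∈ R, g ∣ deg x ∧ deg x ≤ g) →
      2 * g ≤ 2 * deg k + deg l + (R.map deg).sum → False := by
    intro g hg a b c d e f
    refine nz (.inl ⟨g, hg, ?_, ?_⟩)
    · simp only [Multiset.mem_cons, forall_eq_or_imp, hd.deg_mul, ← hk]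
      exact ⟨⟨a, b⟩, ⟨a, b⟩, ⟨c, d⟩, e⟩
    · simp only [Multiset.map_cons, Multiset.sum_cons, hd.deg_mul]; omega
  -- An obstruction `g` to using `l` either already obstructs one of the given products, or yields
  -- `l' ∈ R` of degree `g` or `-g` that can replace `l`.
  by_cases P2 : Degenerate deg (i * k * l ::ₘ j ::ₘ R)
  · simp only [Degenerate, Multiset.mem_cons, forall_eq_or_imp, hd.deg_mul, Multiset.map_cons,
      Multiset.sum_cons] at P2
    rcases P2 with ⟨g, hg, ⟨⟨h1, h1'⟩, ⟨h2, h2'⟩, hx⟩, hs⟩ | ⟨g, hg, ⟨⟨h1, h1'⟩, ⟨h2, h2'⟩, hx⟩, hs⟩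
    · have hgj : g ≤ -deg j := Int.le_of_dvd (by omega) h2.neg_right
      have hg0 : 0 < g := by
        rcases hg.eq_or_lt with rfl | h
        · rw [zero_dvd_iff] at h2; omega
        · exact h
      have hsum : g < (R.map deg).sum := by omega
      obtain ⟨l', R', rfl, hl'⟩ := exists_cons_of_sum_pos hx (by omega)
      simp only [Multiset.mem_cons, forall_eq_or_imp, Multiset.map_cons, Multiset.sum_cons]
        at hx hsum hs hR sat
      have key : g ∣ deg i → g ∣ deg k → deg k ≤ g → False := by
        intro a b c
        have h3 : g ∣ deg l := (dvd_add_right (dvd_add a b)).1 h1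
        exact sat g hg b c h3 (by omega) hx (by omega)
      by_cases hkg : deg k = g
      · exfalso
        refine key ?_ (by rw [hkg]) hkg.le
        have : deg i = deg k + -deg j := by omega
        rw [this, hkg]
        exact dvd_add dvd_rfl h2.neg_right
      by_cases hk0' : deg k = 0
      · exfalso
        refine key ?_ (by simp [hk0']) (by omega)
        have : deg i = -deg j := by omega
        rw [this]; exact h2.neg_right
      obtain ⟨l'', R'', rfl, hl''⟩ := exists_cons_of_sum_pos hx.2 (by omega)
      simp only [Multiset.mem_cons, forall_eq_or_imp, Multiset.map_cons, Multiset.sum_cons]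
        at hx hsum hs hR
      refine alt l' _ rfl (by omega) (by omega) (not_degenerate_of_sum_pos ?_ ?_)
        (not_degenerate_of_sum_pos ?_ ?_)
      · simp only [Multiset.map_cons, Multiset.sum_cons, hd.deg_mul]; omega
      · intro g' hg' hx' hs'
        simp only [Multiset.mem_cons, forall_eq_or_imp, hd.deg_mul] at hx'
        have := Int.le_of_dvd (by omega) hx'.2.2.2.1.1
        omega
      · simp only [Multiset.map_cons, Multiset.sum_cons, hd.deg_mul]; omega
      · intro g' hg' hx' hs'
        simp only [Multiset.mem_cons, forall_eq_or_imp, hd.deg_mul] at hx'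
        have := Int.le_of_dvd (by omega) hx'.2.1.1.neg_right
        omega
    · have hg0 : 0 < g := by
        rcases hg.eq_or_lt with rfl | h
        · rw [zero_dvd_iff] at h2; omega
        · exact h
      have hgj : -deg j = g := Int.eq_of_dvd_of_pos_of_le h2.neg_right (by omega) (by omega)
      have hsum : (R.map deg).sum < 0 := by
        by_contra! hc
        omega
      obtain ⟨l', R', rfl, hl'⟩ := exists_cons_of_sum_neg hx hsum
      simp only [Multiset.mem_cons, forall_eq_or_imp, Multiset.map_cons, Multiset.sum_cons]
        at hx hsum hs hR sat
      refine alt l' _ rfl (by omega) (by omega) (not_degenerate_of_sum_neg ?_ ?_)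
        (not_degenerate_of_sum_neg ?_ ?_)
      · simp only [Multiset.map_cons, Multiset.sum_cons, hd.deg_mul]; omega
      · intro g' hg' hx' hs'
        simp only [Multiset.mem_cons, forall_eq_or_imp, hd.deg_mul, Multiset.map_cons,
          Multiset.sum_cons] at hx' hs'
        obtain ⟨⟨a1, a1'⟩, ⟨a2, a2'⟩, ⟨a3, a3'⟩, a4⟩ := hx'
        have fin : g ∣ deg k → g ∣ deg l → -g ≤ deg l → False := by
          intro b1 b2 b3
          refine nz (.inr ⟨g, hg, ?_, ?_⟩)
          · simp only [Multiset.mem_cons, forall_eq_or_imp, hd.deg_mul, ← hk]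
            exact ⟨⟨b1, by omega⟩, ⟨b1, by omega⟩, ⟨b2, b3⟩, hx⟩
          · simp only [Multiset.map_cons, Multiset.sum_cons, hd.deg_mul]; omega
        by_cases hR' : (R'.map deg).sum < 0
        · obtain ⟨x, R'', rfl, hx2⟩ := exists_cons_of_sum_neg hx.2 hR'
          have := a4 x (by simp)
          have := Int.eq_of_dvd_of_pos_of_le this.1.neg_right (by omega) (by omega)
          obtain rfl : g' = g := by omega
          exact fin a2 a3 a3'
        · by_cases hk00 : deg k = 0
          · exact fin (by simp [hk00]) (by
              have : deg l = -g := by omega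
              simp [this]) (by omega)
          · have := Int.le_of_dvd (by omega) a2
            omega
      · simp only [Multiset.map_cons, Multiset.sum_cons, hd.deg_mul]; omega
      · intro g' hg' hx' hs'
        simp only [Multiset.mem_cons, forall_eq_or_imp, hd.deg_mul] at hx'
        obtain ⟨⟨a1, a1'⟩, ⟨a2, a2'⟩, ⟨a3, a3'⟩, a4⟩ := hx'
        have := Int.eq_of_dvd_of_pos_of_le a2.neg_right (by omega) (by omega)
        obtain rfl : g' = g := by omega
        refine nz' (.inr ⟨g', hg, ?_, ?_⟩)
        · simp only [Multiset.mem_cons, forall_eq_or_imp, hd.deg_mul]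
          have h5 : g' ∣ deg l' := hx.1.1
          exact ⟨⟨(dvd_add_left h5).1 a1, by omega⟩, ⟨a2, by omega⟩, ⟨a3, a3'⟩, hx⟩
        · simp only [Multiset.map_cons, Multiset.sum_cons, hd.deg_mul]; omega
  by_cases P1 : Degenerate deg (i * j * l ::ₘ k ::ₘ R)
  · simp only [Degenerate, Multiset.mem_cons, forall_eq_or_imp, hd.deg_mul, Multiset.map_cons,
      Multiset.sum_cons, ← hk] at P1
    rcases P1 with ⟨g, hg, ⟨⟨h1, h1'⟩, ⟨h2, h2'⟩, hx⟩, hs⟩ | ⟨g, hg, ⟨⟨h1, h1'⟩, ⟨h2, h2'⟩, hx⟩, hs⟩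
    · exact (sat g hg h2 h2' ((dvd_add_right h2).1 h1) (by omega) hx (by omega)).elim
    · have h3 : g ∣ deg l := (dvd_add_right h2).1 h1
      have hlg : deg l < -g := by
        by_contra! hc
        refine nz (.inr ⟨g, hg, ?_, ?_⟩)
        · simp only [Multiset.mem_cons, forall_eq_or_imp, hd.deg_mul, ← hk]
          exact ⟨⟨h2, h2'⟩, ⟨h2, h2'⟩, ⟨h3, hc⟩, hx⟩
        · simp only [Multiset.map_cons, Multiset.sum_cons, hd.deg_mul]; omega
      have hg0 : 0 < g := by
        rcases hg.eq_or_lt with rfl | h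
        · rw [zero_dvd_iff] at h2 h3; omega
        · exact h
      obtain ⟨l', R', rfl, hl'⟩ := exists_cons_of_sum_neg hx (by omega)
      simp only [Multiset.mem_cons, forall_eq_or_imp, Multiset.map_cons, Multiset.sum_cons]
        at hx hs hR
      obtain ⟨l'', R'', rfl, hl''⟩ := exists_cons_of_sum_neg hx.2 (by omega)
      simp only [Multiset.mem_cons, forall_eq_or_imp, Multiset.map_cons, Multiset.sum_cons]
        at hx hs hR
      have aux : ∀ g', 0 < g' → g' ∣ deg l'' → -g' ≤ deg l'' → -g' ≤ deg l → False := by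
        intro g' h0 b1 b2 b3
        have := Int.eq_of_dvd_of_pos_of_le b1.neg_right (by omega) (by omega)
        omega
      refine alt l' _ rfl (by omega) (by omega) (not_degenerate_of_sum_neg ?_ ?_)
        (not_degenerate_of_sum_neg ?_ ?_)
      · simp only [Multiset.map_cons, Multiset.sum_cons, hd.deg_mul]; omega
      · intro g' hg' hx' hs'
        simp only [Multiset.mem_cons, forall_eq_or_imp, hd.deg_mul] at hx'
        exact aux g' hg' hx'.2.2.2.1.1 hx'.2.2.2.1.2 hx'.2.2.1.2
      · simp only [Multiset.map_cons, Multiset.sum_cons, hd.deg_mul]; omega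
      · intro g' hg' hx' hs'
        simp only [Multiset.mem_cons, forall_eq_or_imp, hd.deg_mul] at hx'
        exact aux g' hg' hx'.2.2.2.1.1 hx'.2.2.2.1.2 hx'.2.2.1.2
  exact UniqueProducts.eq_of_third hd hi hj hk hR.1 hil hkl hU hu hu' hk0 P1 P2

/-- If no third factor is available, `R` has only degrees `deg i` and `deg k`. Some `x ∈ R` has
degree `deg i`, as otherwise `deg k` is an obstruction, and the chain passes through `k * x`. -/
theorem UniqueProducts.eq_of_deg_eq_add (hd : IsSwappable deg) {i j k u u' : X}
    {R : Multiset X} (hi : 0 < deg i) (hj : deg j < 0) (hji : -deg i ≤ deg j)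
    (hk : deg k = deg i + deg j)
    (hR : ∀ x ∈ R, -deg i ≤ deg x ∧ deg x ≤ deg i) (hR0 : R ≠ 0)
    (hU : UniqueProducts deg (Multiset.card R + 2))
    (hu : Contracts deg (i * j ::ₘ k ::ₘ R) u)
    (hu' : Contracts deg (i * k ::ₘ j ::ₘ R) u') : u = u' := by
  by_cases hex : ∃ l ∈ R, deg i ≠ deg l ∧ deg k ≠ deg l
  · obtain ⟨l, hl, hil, hkl⟩ := hex
    obtain ⟨R, rfl⟩ := Multiset.exists_cons_of_mem hl
    exact UniqueProducts.eq_of_deg_eq_add_of_exists hd hi hj hji hk hR hil hkl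
      (by simpa using hU) hu hu'
  have hval : ∀ x ∈ R, deg x = deg i ∨ deg x = deg k := by grind
  have nz := hu.not_degenerate hd (by simp)
  have hk0 : 0 ≤ deg k := by omega
  have hx : ∃ x ∈ R, deg x = deg i := by
    by_contra! hc
    have hRk : ∀ x ∈ R, deg x = deg k := fun x hx => (hval x hx).resolve_left (hc x hx)
    refine nz (.inl ⟨deg k, hk0, ?_, ?_⟩)
    · simp only [Multiset.mem_cons, forall_eq_or_imp, hd.deg_mul, ← hk]
      refine ⟨by simp, by simp, fun x hx => by simp [hRk x hx]⟩
    · have := sum_map_nonneg (deg := deg) (m := R) fun x hx => by rw [hRk x hx]; exact hk0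
      simp only [Multiset.map_cons, Multiset.sum_cons, hd.deg_mul]; omega
  obtain ⟨x, hx, hxi⟩ := hx
  obtain ⟨R, rfl⟩ := Multiset.exists_cons_of_mem hx
  simp only [Multiset.mem_cons, forall_eq_or_imp] at hval hR
  have hsum := sum_map_nonneg (deg := deg) (m := R) fun x hx => by
    have := hval.2 x hx; omega
  have hU' : UniqueProducts deg (Multiset.card R + 3) := by simpa using hU
  have hUx : ∀ y : X, UniqueProducts deg (Multiset.card (y ::ₘ R) + 2) := fun _ => by simpa using hU
  -- If `deg k = 0`, then `k * x` has the degree of `i` and cannot be multiplied by it, so the chain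
  -- makes a detour through `k * j`.
  rcases hk0.eq_or_lt with hk0 | hk0
  · have hsum0 : (R.map deg).sum < deg i := by
      by_contra! hc
      refine nz (.inl ⟨deg i, hi.le, ?_, ?_⟩)
      · simp only [Multiset.mem_cons, forall_eq_or_imp, hd.deg_mul, ← hk, ← hk0, hxi]
        refine ⟨by simp; omega, by simp; omega, by simp, fun y hy => ?_⟩
        rcases hval.2 y hy with h | h
        · simp [h]
        · simp [h, ← hk0]; omega
      · simp only [Multiset.map_cons, Multiset.sum_cons, hd.deg_mul]; omega
    have hnd : ∀ {y z : X}, deg y = 0 → deg z = deg i → ¬ Degenerate deg (y ::ₘ z ::ₘ R) := by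
      intro y z hy hz
      refine not_degenerate_of_sum_pos (by simp; omega) fun g hg hx hs => ?_
      simp only [Multiset.mem_cons, forall_eq_or_imp, Multiset.map_cons, Multiset.sum_cons]
        at hx hs
      omega
    obtain ⟨w, hw⟩ := exists_contracts hd (by simp)
      (hnd (y := k * x * j) (z := i) (by simp only [hd.deg_mul]; omega) rfl)
    obtain ⟨v, hv⟩ := exists_contracts hd (by simp)
      (hnd (y := k * i * j) (z := x) (by simp only [hd.deg_mul]; omega) hxi)
    have hw₁ : Contracts deg (k * x ::ₘ j ::ₘ i ::ₘ R) w :=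
      .mul (by rw [hd.deg_mul]; omega) hw
    have hv₁ : Contracts deg (k * i ::ₘ j ::ₘ x ::ₘ R) v :=
      .mul (by rw [hd.deg_mul]; omega) hv
    rw [hd.swap k i j (by omega) (by omega) (by omega) (by omega)] at hv
    have hv₂ : Contracts deg (k * j ::ₘ i ::ₘ x ::ₘ R) v :=
      .mul (by rw [hd.deg_mul]; omega) hv
    rw [Multiset.cons_swap i] at hv₂
    have e₁ : u = w := by
      rw [Multiset.cons_swap j] at hw₁
      exact hU'.eq_of_disjoint hd hu hw₁ (by omega) (by omega)
        (hnd (by rw [hd.deg_mul]; omega) (by rw [hd.deg_mul]; omega))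
    have e₂ : w = v := (hUx i).eq_of_swap hd hw₁ hv₂ (by omega) (by omega) (by omega) (by omega) hw
    rw [mul_comm] at hu'
    exact e₁.trans (e₂.trans (hU _ _ _ (by simp) hv₁ hu'))
  · have h₁ : ¬ Degenerate deg (i * j ::ₘ k * x ::ₘ R) := by
      refine not_degenerate_of_sum_pos ?_ fun g hg hx hs => ?_
      · simp only [Multiset.map_cons, Multiset.sum_cons, hd.deg_mul]; omega
      · simp only [Multiset.mem_cons, forall_eq_or_imp, hd.deg_mul, ← hk] at hx
        have := Int.le_of_dvd hk0 hx.1.1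
        omega
    have h₂ : ¬ Degenerate deg (k * x * i ::ₘ j ::ₘ R) := by
      refine not_degenerate_of_sum_pos ?_ fun g hg hx hs => ?_
      · simp only [Multiset.map_cons, Multiset.sum_cons, hd.deg_mul]; omega
      · simp only [Multiset.mem_cons, forall_eq_or_imp, hd.deg_mul] at hx
        have := Int.le_of_dvd (by omega) hx.2.1.1.neg_right
        omega
    obtain ⟨w, hw⟩ := exists_contracts hd (by simp) h₂
    have hw₁ : Contracts deg (k * x ::ₘ i ::ₘ j ::ₘ R) w :=
      .mul (by rw [hd.deg_mul]; omega) hw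
    rw [mul_comm, Multiset.cons_swap j] at hu'
    exact (hU'.eq_of_disjoint hd hu hw₁ (by omega) (by omega) h₁).trans
      ((hUx j).eq_of_swap hd hw₁ hu' (by omega) (by omega) (by omega) (by omega) hw)

theorem UniqueProducts.eq_of_not_degenerate (hd : IsSwappable deg) {i j k u u' : X}
    {R : Multiset X} (hi : 0 < deg i)
    (hR : ∀ x ∈ j ::ₘ k ::ₘ R, -deg i ≤ deg x ∧ deg x ≤ deg i) (hR0 : R ≠ 0)
    (hij : deg i ≠ deg j) (hik : deg i ≠ deg k)
    (hU : UniqueProducts deg (Multiset.card R + 2))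
    (hu : Contracts deg (i * j ::ₘ k ::ₘ R) u)
    (hu' : Contracts deg (i * k ::ₘ j ::ₘ R) u')
    (h : ¬ Degenerate deg (i * j * k ::ₘ R)) : u = u' := by
  simp only [Multiset.mem_cons, forall_eq_or_imp] at hR
  by_cases h₁ : deg k = deg i + deg j
  · exact hU.eq_of_deg_eq_add hd hi (by omega) hR.1.1 h₁ hR.2.2 hR0 hu hu'
  by_cases h₂ : deg j = deg i + deg k
  · exact (hU.eq_of_deg_eq_add hd hi (by omega) hR.2.1.1 h₂ hR.2.2 hR0 hu' hu).symm
  obtain ⟨w, hw⟩ := exists_contracts hd (by simp) h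
  exact hU.eq_of_swap hd hu hu' hij hik (by omega) (by omega) hw

/-- A product beginning with `i * l` is compared with each side by
`UniqueProducts.eq_of_not_degenerate`. -/
theorem UniqueProducts.eq_of_intermediate (hd : IsSwappable deg) {i j k l u u' : X}
    {R : Multiset X} (hi : 0 < deg i)
    (hR : ∀ x ∈ j ::ₘ k ::ₘ l ::ₘ R, -deg i ≤ deg x ∧ deg x ≤ deg i)
    (hij : deg i ≠ deg j) (hik : deg i ≠ deg k) (hil : deg i ≠ deg l)
    (hU : UniqueProducts deg (Multiset.card R + 3))
    (hu : Contracts deg (i * j ::ₘ k ::ₘ l ::ₘ R) u)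
    (hu' : Contracts deg (i * k ::ₘ j ::ₘ l ::ₘ R) u')
    (h : ¬ Degenerate deg (i * l ::ₘ j ::ₘ k ::ₘ R))
    (hj : ¬ Degenerate deg (i * j * l ::ₘ k ::ₘ R))
    (hk : ¬ Degenerate deg (i * k * l ::ₘ j ::ₘ R)) : u = u' := by
  simp only [Multiset.mem_cons, forall_eq_or_imp] at hR
  obtain ⟨w, hw⟩ := exists_contracts hd (by simp) h
  have hw' := hw
  rw [Multiset.cons_swap k] at hu
  rw [Multiset.cons_swap j] at hu' hw'
  have hU' : ∀ y : X, UniqueProducts deg (Multiset.card (y ::ₘ R) + 2) := fun _ => by simpa using hU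
  refine ((hU' k).eq_of_not_degenerate hd hi ?_ (by simp) hij hil hu hw hj).trans
    ((hU' j).eq_of_not_degenerate hd hi ?_ (by simp) hik hil hu' hw' hk).symm
  all_goals
    simp only [Multiset.mem_cons, forall_eq_or_imp]
    tauto

/-- When `i * j * k` leads to an obstruction `g`, extreme degrees occur in `R`, and an element of
`R` usually serves as an intermediate partner of `i`. The exception is `R` consisting only of
elements of degree `deg i`. -/
theorem UniqueProducts.eq_of_max (hd : IsSwappable deg) {i j k u u' : X}
    {R : Multiset X} (hi : 0 < deg i)
    (hR : ∀ x ∈ j ::ₘ k ::ₘ R, -deg i ≤ deg x ∧ deg x ≤ deg i) (hR0 : R ≠ 0)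
    (hij : deg i ≠ deg j) (hik : deg i ≠ deg k)
    (hU : UniqueProducts deg (Multiset.card R + 2))
    (hu : Contracts deg (i * j ::ₘ k ::ₘ R) u)
    (hu' : Contracts deg (i * k ::ₘ j ::ₘ R) u') : u = u' := by
  by_cases hD : Degenerate deg (i * j * k ::ₘ R)
  swap
  · exact hU.eq_of_not_degenerate hd hi hR hR0 hij hik hu hu' hD
  have nz := hu.not_degenerate hd (by simp)
  have nz' := hu'.not_degenerate hd (by simp)
  have mid : ∀ l R', R = l ::ₘ R' → deg i ≠ deg l →
      ¬ Degenerate deg (i * l ::ₘ j ::ₘ k ::ₘ R') →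
      ¬ Degenerate deg (i * j * l ::ₘ k ::ₘ R') →
      ¬ Degenerate deg (i * k * l ::ₘ j ::ₘ R') → u = u' := by
    rintro l R' rfl hil h1 h2 h3
    exact UniqueProducts.eq_of_intermediate hd hi hR hij hik hil (by simpa using hU) hu hu' h1 h2 h3
  -- the two products with `i` that are known not to be degenerate
  have sat : ∀ g, 0 ≤ g → (g ∣ deg i + deg j ∧ deg i + deg j ≤ g ∧ g ∣ deg k ∧ deg k ≤ g ∨
      g ∣ deg i + deg k ∧ deg i + deg k ≤ g ∧ g ∣ deg j ∧ deg j ≤ g) →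
      (∀ x ∈ R, g ∣ deg x ∧ deg x ≤ g) →
      2 * g ≤ deg i + deg j + deg k + (R.map deg).sum → False := by
    rintro g hg (⟨a, b, c, d⟩ | ⟨a, b, c, d⟩) e f
    · refine nz (.inl ⟨g, hg, ?_, ?_⟩)
      · simp only [Multiset.mem_cons, forall_eq_or_imp, hd.deg_mul]
        exact ⟨⟨a, b⟩, ⟨c, d⟩, e⟩
      · simp only [Multiset.map_cons, Multiset.sum_cons, hd.deg_mul]; omega
    · refine nz' (.inl ⟨g, hg, ?_, ?_⟩)
      · simp only [Multiset.mem_cons, forall_eq_or_imp, hd.deg_mul]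
        exact ⟨⟨a, b⟩, ⟨c, d⟩, e⟩
      · simp only [Multiset.map_cons, Multiset.sum_cons, hd.deg_mul]; omega
  have sat' : ∀ g, 0 ≤ g → (g ∣ deg i + deg j ∧ g ∣ deg k ∧ -g ≤ deg k ∨
      g ∣ deg i + deg k ∧ g ∣ deg j ∧ -g ≤ deg j) →
      (∀ x ∈ R, g ∣ deg x ∧ -g ≤ deg x) →
      deg i + deg j + deg k + (R.map deg).sum ≤ -(2 * g) → False := by
    simp only [Multiset.mem_cons, forall_eq_or_imp] at hR
    rintro g hg (⟨a, c, d⟩ | ⟨a, c, d⟩) e f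
    · refine nz (.inr ⟨g, hg, ?_, ?_⟩)
      · simp only [Multiset.mem_cons, forall_eq_or_imp, hd.deg_mul]
        exact ⟨⟨a, by omega⟩, ⟨c, d⟩, e⟩
      · simp only [Multiset.map_cons, Multiset.sum_cons, hd.deg_mul]; omega
    · refine nz' (.inr ⟨g, hg, ?_, ?_⟩)
      · simp only [Multiset.mem_cons, forall_eq_or_imp, hd.deg_mul]
        exact ⟨⟨a, by omega⟩, ⟨c, d⟩, e⟩
      · simp only [Multiset.map_cons, Multiset.sum_cons, hd.deg_mul]; omega
  simp only [Multiset.mem_cons, forall_eq_or_imp] at hR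
  have zero : deg i + deg j + deg k = 0 → (∀ x ∈ R, deg x = 0) → u = u' := by
    intro he hRz
    obtain ⟨l, hl⟩ := Multiset.exists_mem_of_ne_zero hR0
    obtain ⟨R, rfl⟩ := Multiset.exists_cons_of_mem hl
    have hl0 := hRz l hl
    have hs : (R.map deg).sum = 0 := Multiset.sum_eq_zero fun y hy => by
      obtain ⟨x, hx', rfl⟩ := Multiset.mem_map.1 hy
      exact hRz x (Multiset.mem_cons_of_mem hx')
    have hall : ∀ x ∈ l ::ₘ R, (0 : ℤ) ∣ deg x ∧ deg x ≤ 0 := fun x hx => by simp [hRz x hx]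
    have hsum : 2 * 0 ≤ deg i + deg j + deg k + ((l ::ₘ R).map deg).sum := by
      simp only [Multiset.map_cons, Multiset.sum_cons]; omega
    have hj0 : deg j ≠ 0 := fun h =>
      sat 0 le_rfl (.inr ⟨by simp; omega, by omega, by simp [h], by omega⟩) hall hsum
    have hk0 : deg k ≠ 0 := fun h =>
      sat 0 le_rfl (.inl ⟨by simp; omega, by omega, by simp [h], by omega⟩) hall hsum
    refine mid l R rfl (by omega) (not_degenerate_of_sum_eq_zero (x := j) ?_ (by simp) hj0)
      (not_degenerate_of_sum_eq_zero (x := k) ?_ (by simp) hk0)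
      (not_degenerate_of_sum_eq_zero (x := j) ?_ (by simp) hj0)
    all_goals simp only [Multiset.map_cons, Multiset.sum_cons, hd.deg_mul]; omega
  simp only [Degenerate, Multiset.mem_cons, forall_eq_or_imp, hd.deg_mul, Multiset.map_cons,
      Multiset.sum_cons] at hD
  rcases hD with ⟨g, hg, ⟨⟨he, he'⟩, hx⟩, hs⟩ | ⟨g, hg, ⟨⟨he, he'⟩, hx⟩, hs⟩
  · rcases hg.eq_or_lt with rfl | hg
    · exact zero (zero_dvd_iff.1 he) fun x h => zero_dvd_iff.1 (hx x h).1
    obtain ⟨l, R, rfl, hl⟩ := exists_cons_of_sum_pos hx (by omega)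
    simp only [Multiset.mem_cons, forall_eq_or_imp, Multiset.map_cons, Multiset.sum_cons]
      at hx hs hR sat
    rcases hR.2.2.1.2.eq_or_lt with hgi | hgi
    · -- the elements of `R` have degree `0` or `± deg i`
      have hgi : g = deg i := by omega
      subst hgi
      have hjk : deg i ∣ deg j + deg k := by
        rw [add_assoc] at he; exact (dvd_add_right dvd_rfl).1 he
      -- Otherwise `deg k` is a multiple of `deg i` too, and `g = deg i` obstructs the product
      -- beginning with `i * j`.
      have hj : ¬ deg i ∣ deg j := fun h => by
        have hk : deg i ∣ deg k := (dvd_add_right h).1 hjk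
        have := Int.add_le_of_dvd_of_le dvd_rfl h le_rfl hR.1.2 hg.le hij
        exact sat _ hg.le (.inl ⟨dvd_add dvd_rfl h, this.2, hk, hR.2.1.2⟩) hx (by omega)
      have hk : ¬ deg i ∣ deg k := fun h => hj ((dvd_add_left h).1 hjk)
      by_cases hl' : ∃ l' ∈ R, deg i ≠ deg l'
      · obtain ⟨l', hl', hil'⟩ := hl'
        obtain ⟨R, rfl⟩ := Multiset.exists_cons_of_mem hl'
        simp only [Multiset.mem_cons, forall_eq_or_imp, Multiset.map_cons, Multiset.sum_cons]
          at hx hs hR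
        have aux : ∀ g, 0 < g → g ∣ deg l → deg l ≤ g → g ∣ deg j ∨ g ∣ deg k → False := by
          intro g hg h1 h2 h3
          have := Int.eq_of_dvd_of_pos_of_le h1 (by omega) h2
          obtain rfl : g = deg i := by omega
          tauto
        refine mid l' (l ::ₘ R) (Multiset.cons_swap _ _ _) hil' (not_degenerate_of_sum_pos ?_ ?_)
          (not_degenerate_of_sum_pos ?_ ?_) (not_degenerate_of_sum_pos ?_ ?_)
        · simp only [Multiset.map_cons, Multiset.sum_cons, hd.deg_mul]; omega
        · intro g hg hx _
          simp only [Multiset.mem_cons, forall_eq_or_imp] at hx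
          exact aux g hg hx.2.2.2.1.1 hx.2.2.2.1.2 (.inl hx.2.1.1)
        · simp only [Multiset.map_cons, Multiset.sum_cons, hd.deg_mul]; omega
        · intro g hg hx _
          simp only [Multiset.mem_cons, forall_eq_or_imp] at hx
          exact aux g hg hx.2.2.1.1 hx.2.2.1.2 (.inr hx.2.1.1)
        · simp only [Multiset.map_cons, Multiset.sum_cons, hd.deg_mul]; omega
        · intro g hg hx _
          simp only [Multiset.mem_cons, forall_eq_or_imp] at hx
          exact aux g hg hx.2.2.1.1 hx.2.2.1.2 (.inl hx.2.1.1)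
      · push Not at hl'
        have hji : 0 < deg i + deg j := by
          by_contra! hc
          obtain h : deg j = -deg i := by omega
          exact hj (by rw [h]; exact (dvd_refl _).neg_right)
        have hki : 0 < deg i + deg k := by
          by_contra! hc
          obtain h : deg k = -deg i := by omega
          exact hk (by rw [h]; exact (dvd_refl _).neg_right)
        have hj0 : deg j ≠ 0 := fun h => hj (by simp [h])
        have hk0 : deg k ≠ 0 := fun h => hk (by simp [h])
        -- No element of `R` may be multiplied by `i`. The chain goes from `i * j` to the disjoint
        -- `k * l`, then to `k * i` by a swap.
        have h₁ : ¬ Degenerate deg (i * j ::ₘ l * k ::ₘ R) := by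
          refine not_degenerate_of_sum_pos ?_ fun g' hg' hx' hs' => ?_
          · simp only [Multiset.map_cons, Multiset.sum_cons, hd.deg_mul]; omega
          · simp only [Multiset.mem_cons, forall_eq_or_imp, hd.deg_mul, Multiset.map_cons,
              Multiset.sum_cons] at hx' hs'
            have e1 := Int.eq_of_dvd_of_pos_of_le hx'.1.1 hji hx'.1.2
            have e2 := Int.eq_of_dvd_of_pos_of_le hx'.2.1.1 (by omega) hx'.2.1.2
            have hR' : (R.map deg).sum ≤ 0 := by
              by_contra! hc
              obtain ⟨x, R'', rfl, hxx⟩ := exists_cons_of_sum_pos hx'.2.2 hc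
              have := hl' x (by simp)
              omega
            omega
        have h₂ : ¬ Degenerate deg (k * l * i ::ₘ j ::ₘ R) := by
          refine not_degenerate_of_sum_pos ?_ fun g' hg' hx' hs' => ?_
          · simp only [Multiset.map_cons, Multiset.sum_cons, hd.deg_mul]; omega
          · simp only [Multiset.mem_cons, forall_eq_or_imp, hd.deg_mul] at hx'
            exact hj0 (Int.eq_zero_of_dvd_of_lt hx'.2.1.1 (by omega) (by omega))
        obtain ⟨w, hw⟩ := exists_contracts hd (by simp) h₂
        have hw₁ : Contracts deg (k * l ::ₘ i ::ₘ j ::ₘ R) w :=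
          .mul (by rw [hd.deg_mul]; omega) hw
        rw [mul_comm, Multiset.cons_swap j] at hu'
        rw [mul_comm l k] at h₁
        have hU₁ : UniqueProducts deg (Multiset.card R + 3) := by simpa using hU
        have hU₂ : UniqueProducts deg (Multiset.card (j ::ₘ R) + 2) := by simpa using hU
        exact (hU₁.eq_of_disjoint hd hu hw₁ hij (by omega) h₁).trans
          (hU₂.eq_of_swap hd hw₁ hu' (by omega) (by omega) (by omega) (by omega) hw)
    · have aux : ∀ a b, 0 ≤ deg i + a → (g ∣ deg i + a → deg i + a ≤ g → g ∣ b → b ≤ g → False) →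
          g ∣ deg i + a + b → deg i + a + b ≤ g →
          ∀ g', g' ∣ deg i + a + deg l → deg i + a + deg l ≤ g' → g' ∣ b → b ≤ g' →
          (∀ x ∈ R, g' ∣ deg x ∧ deg x ≤ g') →
          2 * g' ≤ deg i + a + deg l + b + (R.map deg).sum → False := by
        intro a b h0 hf h1 h2 g' a1 a2 a3 a4 a5 a6
        have e1 := Int.eq_of_dvd_of_pos_of_le a1 (by omega) a2
        rcases h0.eq_or_lt with h0 | h0
        · rw [← h0, zero_add] at h1 h2
          exact hf (by simp [← h0]) (by omega) h1 h2
        · have hs : (R.map deg).sum ≤ 0 := by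
            by_contra! hc
            obtain ⟨x, R'', rfl, hxx⟩ := exists_cons_of_sum_pos a5 hc
            have := hx.2 x (by simp)
            omega
          omega
      refine mid l R rfl (by omega) (not_degenerate_of_sum_pos ?_ fun g' hg' hx' hs' => ?_)
          (not_degenerate_of_sum_pos ?_ fun g' hg' hx' hs' => ?_)
          (not_degenerate_of_sum_pos ?_ fun g' hg' hx' hs' => ?_)
      · simp only [Multiset.map_cons, Multiset.sum_cons, hd.deg_mul]; omega
      · simp only [Multiset.mem_cons, forall_eq_or_imp, hd.deg_mul, Multiset.map_cons,
          Multiset.sum_cons] at hx' hs'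
        have e1 := Int.eq_zero_of_dvd_of_lt hx'.2.1.1 (by omega) (by omega)
        have e2 := Int.eq_zero_of_dvd_of_lt hx'.2.2.1.1 (by omega) (by omega)
        obtain ⟨x, R'', rfl, hxx⟩ := exists_cons_of_sum_pos hx'.2.2.2 (by omega)
        have := hR.2.2.2 x (by simp)
        omega
      · simp only [Multiset.map_cons, Multiset.sum_cons, hd.deg_mul]; omega
      · simp only [Multiset.mem_cons, forall_eq_or_imp, hd.deg_mul, Multiset.map_cons,
          Multiset.sum_cons] at hx' hs'
        exact aux (deg j) (deg k) (by omega)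
          (fun b1 b2 b3 b4 => sat g hg.le (.inl ⟨b1, b2, b3, b4⟩) hx (by omega))
          he he' g' hx'.1.1 hx'.1.2 hx'.2.1.1 hx'.2.1.2 hx'.2.2 (by omega)
      · simp only [Multiset.map_cons, Multiset.sum_cons, hd.deg_mul]; omega
      · simp only [Multiset.mem_cons, forall_eq_or_imp, hd.deg_mul, Multiset.map_cons,
          Multiset.sum_cons] at hx' hs'
        exact aux (deg k) (deg j) (by omega)
          (fun b1 b2 b3 b4 => sat g hg.le (.inr ⟨b1, b2, b3, b4⟩) hx (by omega))
          (by rwa [add_right_comm]) (by omega) g' hx'.1.1 hx'.1.2 hx'.2.1.1 hx'.2.1.2 hx'.2.2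
          (by omega)
  · rcases hg.eq_or_lt with rfl | hg
    · exact zero (zero_dvd_iff.1 he) fun x h => zero_dvd_iff.1 (hx x h).1
    obtain ⟨l, R, rfl, hl⟩ := exists_cons_of_sum_neg hx (by omega)
    simp only [Multiset.mem_cons, forall_eq_or_imp, Multiset.map_cons, Multiset.sum_cons]
      at hx hs hR sat'
    have hgl : g ∣ deg l := hx.1.1
    -- any obstruction is the given one
    have aux : ∀ g', (∀ x ∈ R, g' ∣ deg x ∧ -g' ≤ deg x) →
        deg i + deg j + deg k + (deg l + (R.map deg).sum) ≤ -(2 * g') →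
        -g' ≤ deg j ∨ -g' ≤ deg k → g' = g := by
      intro g' h1 h2 h3
      by_cases hc : (R.map deg).sum < 0
      · obtain ⟨x, R'', rfl, hxx⟩ := exists_cons_of_sum_neg hx.2 hc
        have h4 := h1 x (by simp)
        have := Int.eq_of_dvd_of_pos_of_le h4.1.neg_right (by omega) (by omega)
        omega
      · omega
    refine mid l R rfl (by omega) (not_degenerate_of_sum_neg ?_ fun g' hg' hx' hs' => ?_)
      (not_degenerate_of_sum_neg ?_ fun g' hg' hx' hs' => ?_)
      (not_degenerate_of_sum_neg ?_ fun g' hg' hx' hs' => ?_)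
    · simp only [Multiset.map_cons, Multiset.sum_cons, hd.deg_mul]; omega
    · simp only [Multiset.mem_cons, forall_eq_or_imp, hd.deg_mul, Multiset.map_cons,
          Multiset.sum_cons] at hx' hs'
      obtain rfl := aux g' hx'.2.2.2 (by omega) (.inl hx'.2.1.2)
      exact sat' g' hg.le (.inl ⟨dvd_add ((dvd_add_left hgl).1 hx'.1.1) hx'.2.1.1, hx'.2.2.1⟩)
        hx (by omega)
    · simp only [Multiset.map_cons, Multiset.sum_cons, hd.deg_mul]; omega
    · simp only [Multiset.mem_cons, forall_eq_or_imp, hd.deg_mul, Multiset.map_cons,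
          Multiset.sum_cons] at hx' hs'
      obtain rfl := aux g' hx'.2.2 (by omega) (.inr hx'.2.1.2)
      exact sat' g' hg.le (.inl ⟨(dvd_add_left hgl).1 hx'.1.1, hx'.2.1⟩) hx (by omega)
    · simp only [Multiset.map_cons, Multiset.sum_cons, hd.deg_mul]; omega
    · simp only [Multiset.mem_cons, forall_eq_or_imp, hd.deg_mul, Multiset.map_cons,
          Multiset.sum_cons] at hx' hs'
      obtain rfl := aux g' hx'.2.2 (by omega) (.inl hx'.2.1.2)
      exact sat' g' hg.le (.inr ⟨(dvd_add_left hgl).1 hx'.1.1, hx'.2.1⟩) hx (by omega)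

theorem UniqueProducts.succ (hd : IsSwappable deg) {n : ℕ} (hn : 0 < n)
    (hU : UniqueProducts deg n) {i : X} {m : Multiset X} {u u' : X} (hm : Multiset.card m = n)
    (hi : 0 < deg i) (hmax : ∀ x ∈ m, -deg i ≤ deg x ∧ deg x ≤ deg i)
    (hu : Contracts deg (i ::ₘ m) u) (hu' : Contracts deg (i ::ₘ m) u') : u = u' := by
  have hm0 : m ≠ 0 := by rintro rfl; simp at hm; omega
  obtain ⟨j, m₁, rfl, hij, h₁⟩ := hu.exists_partner hd rfl hm0
  obtain ⟨k, m₂, hk, hik, h₂⟩ := hu'.exists_partner hd rfl hm0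
  rcases Multiset.cons_eq_cons.1 hk with ⟨rfl, rfl⟩ | ⟨-, R, rfl, rfl⟩
  · exact hU _ _ _ (by simpa using hm) h₁ h₂
  have hU' : UniqueProducts deg (Multiset.card R + 2) := by
    rw [← hm] at hU; simpa using hU
  by_cases hR : R = 0
  · subst hR
    have hijk := h₁.ne_of_pair hd
    have hikj := h₂.ne_of_pair hd
    rw [hd.deg_mul] at hijk hikj
    exact hU'.eq_of_swap hd h₁ h₂ hij hik hijk hikj (.single _)
  · exact hU'.eq_of_max hd hi hmax hR hij hik h₁ h₂

/-- All products of the same elements agree. -/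
theorem Contracts.unique (hd : IsSwappable deg) {m : Multiset X} {u u' : X}
    (hu : Contracts deg m u) (hu' : Contracts deg m u') : u = u' := by
  suffices ∀ n, UniqueProducts deg (n + 1) by
    obtain ⟨n, hn⟩ := Nat.exists_eq_succ_of_ne_zero (n := Multiset.card m)
      (by simpa using hu.ne_zero)
    exact this n _ _ _ hn hu hu'
  intro n
  induction n with
  | zero =>
    intro m u u' hm hu hu'
    obtain ⟨x, rfl⟩ := Multiset.card_eq_one.1 hm
    exact hu.eq_of_single.trans hu'.eq_of_single.symm
  | succ n ih =>
    intro m u u' hm hu hu'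
    obtain ⟨i, m, rfl, hi⟩ := exists_max_abs_deg (deg := deg) hu.ne_zero
    have hm' : Multiset.card m = n + 1 := by simpa using hm
    rcases lt_trichotomy (deg i) 0 with hneg | hzero | hpos
    · refine ih.neg.succ hd.neg (by omega) hm' (i := i) (by simpa using hneg) (fun x hx => ?_)
        hu.neg hu'.neg
      have := abs_le.1 (hi x (Multiset.mem_cons_of_mem hx))
      rw [abs_of_neg hneg] at this
      omega
    · refine absurd (degenerate_of_forall_deg_eq_zero fun x hx => ?_)
        (hu.not_degenerate hd (by simp [hm']))
      simpa [hzero] using hi x hx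
    · refine ih.succ hd (by omega) hm' hpos (fun x hx => ?_) hu hu'
      have := hi x (Multiset.mem_cons_of_mem hx)
      rw [abs_of_pos hpos] at this
      exact abs_le.1 this

end SwappableMagma

/-! ### From the Lie bracket to a commutative magma -/

section LieGrading

variable {K Q : Type*} [Field K] [LieRing Q] [LieAlgebra K Q]

/-- A family of subspaces of a Lie algebra, compatible with the bracket, whose elements satisfy the
two identities of `U₁`. -/
structure VirasoroFamily (K Q : Type*) [Field K] [LieRing Q] [LieAlgebra K Q] where
  component : ℤ → Submodule K Q
  lie_mem : ∀ {a b : ℤ} {u v : Q}, u ∈ component a → v ∈ component b → ⁅u, v⁆ ∈ component (a + b)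
  lie_eq_zero : ∀ {a : ℤ} {u v : Q}, u ∈ component a → v ∈ component a → ⁅u, v⁆ = 0
  lie_swap : ∀ {a b c : ℤ} {u v w : Q}, u ∈ component a → v ∈ component b → w ∈ component c →
    (((c - a) * (b - c - a) : ℤ) : K) • ⁅⁅u, v⁆, w⁆ =
      (((b - a) * (c - b - a) : ℤ) : K) • ⁅⁅u, w⁆, v⁆

/-- A homogeneous element together with its degree. -/
@[ext]
structure VirasoroFamily.Homogeneous (𝒢 : VirasoroFamily K Q) where
  deg : ℤ
  el : Q
  mem : el ∈ 𝒢.component deg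

namespace VirasoroFamily

variable (𝒢 : VirasoroFamily K Q)

/-- The product is the bracket divided by the coefficient `b - a` of `[e_a, e_b]`. -/
noncomputable instance : CommMagma 𝒢.Homogeneous where
  -- For equal degrees the scalar is `0⁻¹ = 0`; commutativity survives, and `Contracts` never uses
  -- such products.
  mul x y := ⟨x.deg + y.deg, (((y.deg - x.deg : ℤ) : K))⁻¹ • ⁅x.el, y.el⁆,
    Submodule.smul_mem _ _ (𝒢.lie_mem x.mem y.mem)⟩
  mul_comm x y := by
    refine Homogeneous.ext (add_comm _ _) ?_
    change (((y.deg - x.deg : ℤ) : K))⁻¹ • ⁅x.el, y.el⁆ = (((x.deg - y.deg : ℤ) : K))⁻¹ • ⁅y.el, x.el⁆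
    rw [← lie_skew x.el, ← neg_sub y.deg, Int.cast_neg, inv_neg, smul_neg, neg_smul]

theorem deg_mul (x y : 𝒢.Homogeneous) : (x * y).deg = x.deg + y.deg := rfl

theorem el_mul (x y : 𝒢.Homogeneous) :
    (x * y).el = (((y.deg - x.deg : ℤ) : K))⁻¹ • ⁅x.el, y.el⁆ := rfl

/-- The four inequalities say that the factors of `α` and `β` are nonzero in characteristic zero, so
the second identity can be divided by `αβ`. -/
theorem isSwappable [CharZero K] : IsSwappable (fun x : 𝒢.Homogeneous => x.deg) where
  deg_mul := 𝒢.deg_mul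
  swap x y z h₁ h₂ h₃ h₄ := by
    refine Homogeneous.ext (add_right_comm _ _ _) ?_
    have key := 𝒢.lie_swap x.mem y.mem z.mem
    simp only [el_mul, deg_mul, smul_lie, smul_smul]
    have e₁ : ((y.deg - x.deg : ℤ) : K) ≠ 0 := Int.cast_ne_zero.2 (sub_ne_zero.2 h₁.symm)
    have e₂ : ((z.deg - (x.deg + y.deg) : ℤ) : K) ≠ 0 := Int.cast_ne_zero.2 (sub_ne_zero.2 h₂.symm)
    have e₃ : ((z.deg - x.deg : ℤ) : K) ≠ 0 := Int.cast_ne_zero.2 (sub_ne_zero.2 h₃.symm)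
    have e₄ : ((y.deg - (x.deg + z.deg) : ℤ) : K) ≠ 0 := Int.cast_ne_zero.2 (sub_ne_zero.2 h₄.symm)
    rw [show z.deg - y.deg - x.deg = z.deg - (x.deg + y.deg) by ring,
      show y.deg - z.deg - x.deg = y.deg - (x.deg + z.deg) by ring, Int.cast_mul, Int.cast_mul] at key
    have key' := congrArg (fun q => (((y.deg - x.deg : ℤ) : K) * ((z.deg - (x.deg + y.deg) : ℤ) : K) *
      ((z.deg - x.deg : ℤ) : K) * ((y.deg - (x.deg + z.deg) : ℤ) : K))⁻¹ • q) key
    simp only [smul_smul] at key'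
    convert key' using 2 <;> field_simp

end VirasoroFamily

end LieGrading

/-! ### Commutators and their images -/

/-- `IsMonomial m c f`: the element `f` is a commutator in the variables listed in `m`, and `c` is
the coefficient of its value in `U₁` under `x_i^g ↦ e_g`. -/
inductive IsMonomial {K : Type*} [Field K] : Multiset (ℤ × ℕ) → K → FreeGradedLie K ℤ → Prop
  | var (v : ℤ × ℕ) : IsMonomial {v} 1 (FreeLieAlgebra.of K v)
  | lie {m₁ m₂ : Multiset (ℤ × ℕ)} {c₁ c₂ : K} {f₁ f₂ : FreeGradedLie K ℤ} :
      IsMonomial m₁ c₁ f₁ → IsMonomial m₂ c₂ f₂ →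
      IsMonomial (m₁ + m₂)
        ((((m₂.map Prod.fst).sum - (m₁.map Prod.fst).sum : ℤ) : K) * (c₁ * c₂)) ⁅f₁, f₂⁆

/-- The span is a Lie subalgebra. Lifting the variables into it and then including gives an
endomorphism fixing every variable, hence the identity. -/
theorem FreeLieAlgebra.span_eq_top {K V : Type*} [Field K] {S : Set (FreeLieAlgebra K V)}
    (hvar : ∀ v, FreeLieAlgebra.of K v ∈ S) (hlie : ∀ x ∈ S, ∀ y ∈ S, ⁅x, y⁆ ∈ S) :
    Submodule.span K S = ⊤ := by
  have hspan : ∀ x ∈ Submodule.span K S, ∀ y ∈ Submodule.span K S, ⁅x, y⁆ ∈ Submodule.span K S := by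
    intro x hx y hy
    induction hx using Submodule.span_induction with
    | zero => simp
    | add x₁ x₂ _ _ h₁ h₂ => rw [add_lie]; exact add_mem h₁ h₂
    | smul a x _ h => rw [smul_lie]; exact Submodule.smul_mem _ _ h
    | mem x hx =>
      induction hy using Submodule.span_induction with
      | zero => simp
      | add y₁ y₂ _ _ h₁ h₂ => rw [lie_add]; exact add_mem h₁ h₂
      | smul a y _ h => rw [lie_smul]; exact Submodule.smul_mem _ _ h
      | mem y hy => exact Submodule.subset_span (hlie x hx y hy)
  obtain ⟨A, hA⟩ : ∃ A : LieSubalgebra K (FreeLieAlgebra K V), A.toSubmodule = Submodule.span K S :=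
    ⟨{ Submodule.span K S with lie_mem' := fun hx hy => hspan _ hx _ hy }, rfl⟩
  have hmem : ∀ x, x ∈ A ↔ x ∈ Submodule.span K S := fun x => by rw [← hA]; rfl
  have hS : A.incl.comp (FreeLieAlgebra.lift K fun v =>
      (⟨FreeLieAlgebra.of K v, (hmem _).2 (Submodule.subset_span (hvar v))⟩ : A)) = LieHom.id := by
    refine FreeLieAlgebra.hom_ext fun v => ?_
    simp [FreeLieAlgebra.lift_of_apply]
  rw [eq_top_iff]
  intro f _
  have := congrArg (fun φ => φ f) hS
  simp only [LieHom.comp_apply, LieHom.id_apply] at this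
  rw [← this, ← hmem]
  exact (FreeLieAlgebra.lift K _ f : A).2

theorem span_isMonomial (K : Type*) [Field K] :
    Submodule.span K {f : FreeGradedLie K ℤ | ∃ m c, IsMonomial m c f} = ⊤ :=
  FreeLieAlgebra.span_eq_top (fun v => ⟨_, _, .var v⟩)
    fun _ ⟨_, _, hx⟩ _ ⟨_, _, hy⟩ => ⟨_, _, hx.lie hy⟩

namespace IsMonomial

variable {K Q : Type*} [Field K] [CharZero K] [LieRing Q] [LieAlgebra K Q]

/-- The variable `v` as a homogeneous element of the image of the free Lie algebra. -/
noncomputable def variableImage (𝒢 : VirasoroFamily K Q) (φ : FreeGradedLie K ℤ →ₗ⁅K⁆ Q)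
    (hφ : ∀ v : ℤ × ℕ, φ (FreeLieAlgebra.of K v) ∈ 𝒢.component v.1) (v : ℤ × ℕ) :
    𝒢.Homogeneous :=
  ⟨v.1, φ (FreeLieAlgebra.of K v), hφ v⟩

/-- A bracket of equal total degrees makes both the coefficient and the image vanish; any other
bracket is an admissible product scaled by the difference of degrees. -/
theorem map_eq (𝒢 : VirasoroFamily K Q) (φ : FreeGradedLie K ℤ →ₗ⁅K⁆ Q)
    (hφ : ∀ v : ℤ × ℕ, φ (FreeLieAlgebra.of K v) ∈ 𝒢.component v.1)
    {m : Multiset (ℤ × ℕ)} {c : K} {f : FreeGradedLie K ℤ} (h : IsMonomial m c f) :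
    (c = 0 ∧ φ f = 0) ∨ c ≠ 0 ∧ ∃ u, Contracts (fun x : 𝒢.Homogeneous => x.deg)
      (m.map (variableImage 𝒢 φ hφ)) u ∧ φ f = c • u.el := by
  induction h with
  | var v =>
    exact .inr ⟨one_ne_zero, variableImage 𝒢 φ hφ v, by simpa using Contracts.single _,
      by simp [variableImage]⟩
  | @lie m₁ m₂ c₁ c₂ f₁ f₂ _ _ ih₁ ih₂ =>
    rcases ih₁ with ⟨rfl, h₁⟩ | ⟨hc₁, u₁, hu₁, h₁⟩
    · exact .inl (by simp [h₁])
    rcases ih₂ with ⟨rfl, h₂⟩ | ⟨hc₂, u₂, hu₂, h₂⟩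
    · exact .inl (by simp [h₂])
    have d₁ := hu₁.deg_eq 𝒢.isSwappable
    have d₂ := hu₂.deg_eq 𝒢.isSwappable
    rw [Multiset.map_map] at d₁ d₂
    change u₁.deg = (m₁.map Prod.fst).sum at d₁
    change u₂.deg = (m₂.map Prod.fst).sum at d₂
    rw [← d₁, ← d₂, LieHom.map_lie, h₁, h₂, smul_lie, lie_smul, smul_smul]
    by_cases hd : u₁.deg = u₂.deg
    · refine .inl ⟨by simp [hd], ?_⟩
      rw [𝒢.lie_eq_zero u₁.mem (hd ▸ u₂.mem), smul_zero]
    · have hne : ((u₂.deg - u₁.deg : ℤ) : K) ≠ 0 := Int.cast_ne_zero.2 (sub_ne_zero.2 (Ne.symm hd))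
      refine .inr ⟨mul_ne_zero hne (mul_ne_zero hc₁ hc₂), u₁ * u₂, ?_, ?_⟩
      · rw [Multiset.map_add]
        exact hu₁.mul_add hu₂ hd
      · rw [VirasoroFamily.el_mul, smul_smul]
        congr 1
        field_simp

/-- The image of a monomial is determined by its variables and its coefficient. -/
theorem exists_image (𝒢 : VirasoroFamily K Q) (φ : FreeGradedLie K ℤ →ₗ⁅K⁆ Q)
    (hφ : ∀ v : ℤ × ℕ, φ (FreeLieAlgebra.of K v) ∈ 𝒢.component v.1) :
    ∃ N : Multiset (ℤ × ℕ) → Q, ∀ m c f, IsMonomial m c f → φ f = c • N m := by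
  classical
  -- The default value `0` is harmless: without an admissible product, every monomial on `m` has `c
  -- = 0` and image zero.
  refine ⟨fun m => if h : ∃ u, Contracts (fun x : 𝒢.Homogeneous => x.deg)
    (m.map (variableImage 𝒢 φ hφ)) u then h.choose.el else 0, fun m c f hf => ?_⟩
  rcases hf.map_eq 𝒢 φ hφ with ⟨rfl, h⟩ | ⟨-, u, hu, h⟩
  · simp [h]
  · have hex : ∃ u, Contracts (fun x : 𝒢.Homogeneous => x.deg)
      (m.map (variableImage 𝒢 φ hφ)) u := ⟨u, hu⟩
    dsimp only
    rw [dif_pos hex, h, hu.unique 𝒢.isSwappable hex.choose_spec]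

end IsMonomial

/-! ### Values in `U₁` and generic evaluation -/

namespace U₁

variable {K : Type*} [Field K]

theorem ddt_T (n : ℤ) : ddt K (LaurentPolynomial.T n) = (n : K) • LaurentPolynomial.T (n - 1) := by
  have := ddtLinear_C_mul_T K 1 n
  rw [map_one, one_mul, one_mul] at this
  rw [LaurentPolynomial.smul_eq_C_mul, ← this]
  rfl

theorem e_apply (n : ℤ) (p : K[T;T⁻¹]) : e K n p = LaurentPolynomial.T (n + 1) * ddt K p := rfl

theorem lie_e (a b : ℤ) : ⁅e K a, e K b⁆ = ((b - a : ℤ) : K) • e K (a + b) := by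
  refine Derivation.ext fun p => ?_
  rw [Derivation.commutator_apply, Derivation.smul_apply]
  simp only [e_apply, Derivation.leibniz, ddt_T, smul_eq_mul]
  have h₁ : (LaurentPolynomial.T (a + b + 1) : K[T;T⁻¹]) =
      LaurentPolynomial.T (a + 1) * LaurentPolynomial.T (b + 1 - 1) := by
    rw [← LaurentPolynomial.T_add]; congr 1; ring
  have h₂ : (LaurentPolynomial.T (b + 1) * LaurentPolynomial.T (a + 1 - 1) : K[T;T⁻¹]) =
      LaurentPolynomial.T (a + 1) * LaurentPolynomial.T (b + 1 - 1) := by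
    rw [← LaurentPolynomial.T_add, ← LaurentPolynomial.T_add]; congr 1; ring
  simp only [h₁, LaurentPolynomial.smul_eq_C_mul]
  simp only [Int.cast_add, Int.cast_sub, Int.cast_one, map_sub, map_add, map_one]
  linear_combination (-(LaurentPolynomial.C (a : K)) - 1) * ddt K p * h₂

theorem smul_lie_smul (r s : K) (D E : U₁ K) : ⁅r • D, s • E⁆ = (r * s) • ⁅D, E⁆ := by
  refine Derivation.ext fun p => ?_
  rw [Derivation.smul_apply, Derivation.commutator_apply, Derivation.commutator_apply]
  simp only [Derivation.smul_apply]
  rw [D.map_smul s, E.map_smul r, smul_smul, smul_smul, mul_comm s r, smul_sub]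

theorem lie_mem_component {a b : ℤ} {u v : U₁ K} (hu : u ∈ component K a)
    (hv : v ∈ component K b) : ⁅u, v⁆ ∈ component K (a + b) := by
  obtain ⟨r, rfl⟩ := Submodule.mem_span_singleton.1 hu
  obtain ⟨s, rfl⟩ := Submodule.mem_span_singleton.1 hv
  rw [smul_lie_smul, lie_e]
  exact Submodule.smul_mem _ _ (Submodule.smul_mem _ _ (Submodule.mem_span_singleton_self _))

/-- The value at `t = 1` of the coefficient of `d/dt`. -/
noncomputable def coeffAtOne (K : Type*) [Field K] (D : U₁ K) : K :=
  LaurentPolynomial.eval₂ (RingHom.id K) 1 (D (LaurentPolynomial.T 1))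

theorem coeffAtOne_add (D₁ D₂ : U₁ K) :
    coeffAtOne K (D₁ + D₂) = coeffAtOne K D₁ + coeffAtOne K D₂ := by
  simp [coeffAtOne]

theorem coeffAtOne_smul (c : K) (D : U₁ K) : coeffAtOne K (c • D) = c * coeffAtOne K D := by
  simp [coeffAtOne, LaurentPolynomial.smul_eq_C_mul]

theorem coeffAtOne_e (n : ℤ) : coeffAtOne K (e K n) = 1 := by
  simp [coeffAtOne, e_apply, ddt_T]

end U₁

theorem IsMonomial.lift_eq {K : Type*} [Field K] {m : Multiset (ℤ × ℕ)} {c : K}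
    {f : FreeGradedLie K ℤ} (h : IsMonomial m c f) (r : ℤ × ℕ → K) :
    FreeLieAlgebra.lift K (fun v => r v • U₁.e K v.1) f =
      (c * (m.map r).prod) • U₁.e K (m.map Prod.fst).sum := by
  induction h with
  | var v => simp [FreeLieAlgebra.lift_of_apply]
  | lie _ _ ih₁ ih₂ =>
    rw [LieHom.map_lie, ih₁, ih₂, U₁.smul_lie_smul, U₁.lie_e, smul_smul,
      Multiset.map_add, Multiset.map_add, Multiset.prod_add, Multiset.sum_add]
    congr 1
    ring

theorem MvPolynomial.eval_monomial_toFinsupp {σ R : Type*} [DecidableEq σ] [CommRing R]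
    (r : σ → R) (m : Multiset σ) (c : R) :
    MvPolynomial.eval r (MvPolynomial.monomial (Multiset.toFinsupp m) c) = c * (m.map r).prod := by
  induction m using Multiset.induction_on with
  | empty => simp
  | cons a m ih =>
    rw [← Multiset.singleton_add, Multiset.toFinsupp_add, Multiset.toFinsupp_singleton,
      MvPolynomial.monomial_single_add, map_mul, ih]
    simp
    ring

/-- The linear map `B` sends the monomial with exponents `m` to `N m`, so `φ f = B p` for a
polynomial `p` recording the generic values of `f`. `U₁.coeffAtOne` takes the value 1 on every
`e_n`, so `f` need not be split into homogeneous parts. -/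
theorem FreeGradedLie.IsGradedIdentity.map_eq_zero {K Q : Type*} [Field K] [CharZero K] [LieRing Q]
    [LieAlgebra K Q] (𝒢 : VirasoroFamily K Q) (φ : FreeGradedLie K ℤ →ₗ⁅K⁆ Q)
    (hφ : ∀ v : ℤ × ℕ, φ (FreeLieAlgebra.of K v) ∈ 𝒢.component v.1)
    {f : FreeGradedLie K ℤ} (hf : FreeGradedLie.IsGradedIdentity (U₁.component K) f) :
    φ f = 0 := by
  classical
  obtain ⟨N, hN⟩ := IsMonomial.exists_image 𝒢 φ hφ
  let B : MvPolynomial (ℤ × ℕ) K →ₗ[K] Q :=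
    (MvPolynomial.basisMonomials (ℤ × ℕ) K).constr K fun d => N (Finsupp.toMultiset d)
  have key : ∀ f : FreeGradedLie K ℤ, ∃ p : MvPolynomial (ℤ × ℕ) K, φ f = B p ∧ ∀ r : ℤ × ℕ → K,
      U₁.coeffAtOne K (FreeLieAlgebra.lift K (fun v => r v • U₁.e K v.1) f) =
        MvPolynomial.eval r p := by
    intro f
    have hf : f ∈ Submodule.span K {f : FreeGradedLie K ℤ | ∃ m c, IsMonomial m c f} := by
      rw [span_isMonomial]; trivial
    induction hf using Submodule.span_induction with
    | zero => exact ⟨0, by simp, fun r => by simp [U₁.coeffAtOne]⟩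
    | add f₁ f₂ _ _ h₁ h₂ =>
      obtain ⟨p₁, h₁, h₁'⟩ := h₁
      obtain ⟨p₂, h₂, h₂'⟩ := h₂
      exact ⟨p₁ + p₂, by rw [map_add, map_add, h₁, h₂], fun r => by
        rw [map_add, map_add, U₁.coeffAtOne_add, h₁', h₂']⟩
    | smul a f _ h =>
      obtain ⟨p, h, h'⟩ := h
      exact ⟨a • p, by rw [map_smul, map_smul, h], fun r => by
        rw [map_smul, U₁.coeffAtOne_smul, h', MvPolynomial.smul_eval]⟩
    | mem f hf =>
      obtain ⟨m, c, hf⟩ := hf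
      refine ⟨MvPolynomial.monomial (Multiset.toFinsupp m) c, ?_, fun r => ?_⟩
      · have hB : B (MvPolynomial.monomial (Multiset.toFinsupp m) 1) = N m := by
          have := (MvPolynomial.basisMonomials (ℤ × ℕ) K).constr_basis K
            (fun d => N (Finsupp.toMultiset d)) (Multiset.toFinsupp m)
          simpa using this
        rw [hN m c f hf, ← hB, ← map_smul, MvPolynomial.smul_monomial, smul_eq_mul, mul_one]
      · rw [hf.lift_eq, U₁.coeffAtOne_smul, U₁.coeffAtOne_e, mul_one,
          MvPolynomial.eval_monomial_toFinsupp]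
  obtain ⟨p, hp, hp'⟩ := key f
  -- `K` is infinite, so a polynomial vanishing at every point is zero.
  have : p = 0 := MvPolynomial.funext fun r => by
    rw [← hp' r, hf _ fun g i => Submodule.smul_mem _ _ (Submodule.mem_span_singleton_self _)]
    simp [U₁.coeffAtOne]
  rw [hp, this, map_zero]

/-! ### The ideal generated by the basic identities -/

namespace FreeGradedLie

variable {K : Type*} [Field K]

section

variable {G : Type*} [AddCommGroup G]

theorem lie_mem_component {g h : G} {u v : FreeGradedLie K G} (hu : u ∈ component K g)
    (hv : v ∈ component K h) : ⁅u, v⁆ ∈ component K (g + h) := by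
  induction hu using Submodule.span_induction with
  | zero => simp
  | add x₁ x₂ _ _ h₁ h₂ => rw [add_lie]; exact add_mem h₁ h₂
  | smul a x _ h => rw [smul_lie]; exact Submodule.smul_mem _ _ h
  | mem x hx =>
    induction hv using Submodule.span_induction with
    | zero => simp
    | add y₁ y₂ _ _ h₁ h₂ => rw [lie_add]; exact add_mem h₁ h₂
    | smul a y _ h => rw [lie_smul]; exact Submodule.smul_mem _ _ h
    | mem y hy => exact Submodule.subset_span (.lie hx hy)

theorem x_mem_component (i : ℕ) (g : G) : x K i g ∈ component K g :=
  Submodule.subset_span (.var i g)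

theorem lift_mem {L : Type*} [LieRing L] [LieAlgebra K L] {𝒜 : G → Submodule K L}
    (hlie : ∀ {g h : G} {u v : L}, u ∈ 𝒜 g → v ∈ 𝒜 h → ⁅u, v⁆ ∈ 𝒜 (g + h))
    {a : G × ℕ → L} (ha : ∀ g i, a (g, i) ∈ 𝒜 g) {g : G} {f : FreeGradedLie K G}
    (hf : f ∈ component K g) : FreeLieAlgebra.lift K a f ∈ 𝒜 g := by
  induction hf using Submodule.span_induction with
  | zero => simp
  | add x₁ x₂ _ _ h₁ h₂ => rw [map_add]; exact add_mem h₁ h₂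
  | smul a x _ h => rw [map_smul]; exact Submodule.smul_mem _ _ h
  | mem x hx =>
    change IsCommutator g x at hx
    induction hx with
    | var i g => rw [FreeGradedLie.x, FreeLieAlgebra.lift_of_apply]; exact ha g i
    | lie _ _ h₁ h₂ => rw [LieHom.map_lie]; exact hlie h₁ h₂

theorem isGradedEnd_lift {a : G × ℕ → FreeGradedLie K G} (ha : ∀ g i, a (g, i) ∈ component K g) :
    IsGradedEnd (FreeLieAlgebra.lift K a) :=
  fun _ _ hf => lift_mem lie_mem_component ha hf

theorem mem_tIdealSpan {S : Set (FreeGradedLie K G)} {f : FreeGradedLie K G} :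
    f ∈ tIdealSpan S ↔ ∀ I, IsTIdeal I ∧ S ⊆ I → f ∈ I := by
  rw [tIdealSpan, ← SetLike.mem_coe, LieSubmodule.coe_sInf]
  simp

theorem subset_tIdealSpan (S : Set (FreeGradedLie K G)) : S ⊆ tIdealSpan S :=
  fun _ hf => mem_tIdealSpan.2 fun _ hI => hI.2 hf

theorem isTIdeal_tIdealSpan (S : Set (FreeGradedLie K G)) : IsTIdeal (tIdealSpan S) := by
  intro φ hφ f hf
  rw [mem_tIdealSpan] at hf ⊢
  exact fun I hI => hI.1 φ hφ f (hf I hI)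

theorem tIdealSpan_le {S : Set (FreeGradedLie K G)} {I : LieIdeal K (FreeGradedLie K G)}
    (hI : IsTIdeal I) (hS : S ⊆ I) : tIdealSpan S ≤ I :=
  sInf_le ⟨hI, hS⟩

/-- The ideal of graded identities. -/
def identityIdeal {L : Type*} [LieRing L] [LieAlgebra K L] (𝒜 : G → Submodule K L) :
    LieIdeal K (FreeGradedLie K G) where
  carrier := {f | IsGradedIdentity 𝒜 f}
  add_mem' hf hg a ha := by rw [map_add, hf a ha, hg a ha, add_zero]
  zero_mem' a _ := map_zero _
  smul_mem' c f hf a ha := by rw [map_smul, hf a ha, smul_zero]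
  lie_mem hf a ha := by rw [LieHom.map_lie, hf a ha, lie_zero]

theorem isTIdeal_identityIdeal {L : Type*} [LieRing L] [LieAlgebra K L] {𝒜 : G → Submodule K L}
    (hlie : ∀ {g h : G} {u v : L}, u ∈ 𝒜 g → v ∈ 𝒜 h → ⁅u, v⁆ ∈ 𝒜 (g + h)) :
    IsTIdeal (identityIdeal 𝒜) := by
  intro φ hφ f hf a ha
  have : (FreeLieAlgebra.lift K a).comp φ =
      FreeLieAlgebra.lift K fun v => FreeLieAlgebra.lift K a (φ (FreeLieAlgebra.of K v)) :=
    FreeLieAlgebra.hom_ext fun v => by rw [FreeLieAlgebra.lift_of_apply, LieHom.comp_apply]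
  rw [← LieHom.comp_apply, this]
  exact hf _ fun g i => lift_mem hlie ha (hφ g _ (x_mem_component i g))

end

/-- The two families of graded identities of `U₁`. -/
def basicIdentities (K : Type*) [Field K] : Set (FreeGradedLie K ℤ) :=
  {f | ∃ i : ℤ, f = ⁅x K 1 i, x K 2 i⁆} ∪
  {f | ∃ a b c : ℤ, f = (((c - a) * (b - c - a) : ℤ) : K) • ⁅⁅x K 1 a, x K 2 b⁆, x K 3 c⁆ -
    (((b - a) * (c - b - a) : ℤ) : K) • ⁅⁅x K 1 a, x K 3 c⁆, x K 2 b⁆}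

theorem basicIdentities_subset : basicIdentities K ⊆ identityIdeal (U₁.component K) := by
  rintro f (⟨i, rfl⟩ | ⟨a, b, c, rfl⟩) s hs
  · obtain ⟨r₁, h₁⟩ := Submodule.mem_span_singleton.1 (hs i 1)
    obtain ⟨r₂, h₂⟩ := Submodule.mem_span_singleton.1 (hs i 2)
    simp only [x, LieHom.map_lie, FreeLieAlgebra.lift_of_apply]
    rw [← h₁, ← h₂, U₁.smul_lie_smul, lie_self, smul_zero]
  · obtain ⟨r₁, h₁⟩ := Submodule.mem_span_singleton.1 (hs a 1)
    obtain ⟨r₂, h₂⟩ := Submodule.mem_span_singleton.1 (hs b 2)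
    obtain ⟨r₃, h₃⟩ := Submodule.mem_span_singleton.1 (hs c 3)
    simp only [x, map_sub, map_smul, LieHom.map_lie, FreeLieAlgebra.lift_of_apply]
    rw [← h₁, ← h₂, ← h₃]
    simp only [U₁.smul_lie_smul, U₁.lie_e, smul_smul]
    rw [add_right_comm a c b, ← sub_smul]
    convert zero_smul K _
    push_cast
    ring

/-- Invariance under the graded endomorphism sending the two variables to `u` and `v` extends the
identity from variables to arbitrary homogeneous elements. -/
theorem lie_mem_tIdealSpan {a : ℤ} {u v : FreeGradedLie K ℤ} (hu : u ∈ component K a)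
    (hv : v ∈ component K a) : ⁅u, v⁆ ∈ tIdealSpan (basicIdentities K) := by
  let s : ℤ × ℕ → FreeGradedLie K ℤ := fun p =>
    if p = (a, 1) then u else if p = (a, 2) then v else FreeLieAlgebra.of K p
  have hs : ∀ g i, s (g, i) ∈ component K g := by
    intro g i
    simp only [s]
    split_ifs with h₁ h₂
    · cases h₁; exact hu
    · cases h₂; exact hv
    · exact x_mem_component i g
  have := isTIdeal_tIdealSpan (basicIdentities K) _ (isGradedEnd_lift hs) _
    (subset_tIdealSpan _ (.inl ⟨a, rfl⟩))
  simpa [x, FreeLieAlgebra.lift_of_apply, s] using this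

theorem swap_mem_tIdealSpan {a b c : ℤ} {u v w : FreeGradedLie K ℤ} (hu : u ∈ component K a)
    (hv : v ∈ component K b) (hw : w ∈ component K c) :
    (((c - a) * (b - c - a) : ℤ) : K) • ⁅⁅u, v⁆, w⁆ -
      (((b - a) * (c - b - a) : ℤ) : K) • ⁅⁅u, w⁆, v⁆ ∈ tIdealSpan (basicIdentities K) := by
  let s : ℤ × ℕ → FreeGradedLie K ℤ := fun p =>
    if p = (a, 1) then u else if p = (b, 2) then v else if p = (c, 3) then w
    else FreeLieAlgebra.of K p
  have hs : ∀ g i, s (g, i) ∈ component K g := by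
    intro g i
    simp only [s]
    split_ifs with h₁ h₂ h₃
    · cases h₁; exact hu
    · cases h₂; exact hv
    · cases h₃; exact hw
    · exact x_mem_component i g
  have := isTIdeal_tIdealSpan (basicIdentities K) _ (isGradedEnd_lift hs) _
    (subset_tIdealSpan _ (.inr ⟨a, b, c, rfl⟩))
  have e₁ : FreeLieAlgebra.lift K s (x K 1 a) = u := by
    simp [x, FreeLieAlgebra.lift_of_apply, s]
  have e₂ : FreeLieAlgebra.lift K s (x K 2 b) = v := by
    simp [x, FreeLieAlgebra.lift_of_apply, s]
  have e₃ : FreeLieAlgebra.lift K s (x K 3 c) = w := by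
    simp [x, FreeLieAlgebra.lift_of_apply, s]
  rwa [map_sub, map_smul, map_smul, LieHom.map_lie, LieHom.map_lie, LieHom.map_lie,
    LieHom.map_lie, e₁, e₂, e₃] at this

/-- The images of the homogeneous components under a homomorphism that kills the basic
identities. -/
noncomputable def imageFamily {Q : Type*} [LieRing Q] [LieAlgebra K Q]
    (φ : FreeGradedLie K ℤ →ₗ⁅K⁆ Q) (hφ : ∀ f ∈ tIdealSpan (basicIdentities K), φ f = 0) :
    VirasoroFamily K Q where
  component a := (component K a).map (φ : FreeGradedLie K ℤ →ₗ[K] Q)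
  lie_mem := by
    intro a b _ _ hx hy
    obtain ⟨u, hu, rfl⟩ := Submodule.mem_map.1 hx
    obtain ⟨v, hv, rfl⟩ := Submodule.mem_map.1 hy
    exact Submodule.mem_map.2 ⟨⁅u, v⁆, lie_mem_component hu hv, LieHom.map_lie φ u v⟩
  lie_eq_zero := by
    intro a _ _ hx hy
    obtain ⟨u, hu, rfl⟩ := Submodule.mem_map.1 hx
    obtain ⟨v, hv, rfl⟩ := Submodule.mem_map.1 hy
    exact (LieHom.map_lie φ u v).symm.trans (hφ _ (lie_mem_tIdealSpan hu hv))
  lie_swap := by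
    intro a b c _ _ _ hx hy hz
    obtain ⟨u, hu, rfl⟩ := Submodule.mem_map.1 hx
    obtain ⟨v, hv, rfl⟩ := Submodule.mem_map.1 hy
    obtain ⟨w, hw, rfl⟩ := Submodule.mem_map.1 hz
    have := hφ _ (swap_mem_tIdealSpan hu hv hw)
    simp only [map_sub, map_smul, LieHom.map_lie] at this
    exact sub_eq_zero.1 this

/-- The quotient of the free graded Lie algebra by the ideal generated by the basic identities. -/
abbrev RelativelyFree (K : Type*) [Field K] : Type _ :=
  FreeGradedLie K ℤ ⧸ tIdealSpan (basicIdentities K)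

/-- The projection onto the quotient by the ideal generated by the basic identities. -/
noncomputable def toRelativelyFree (K : Type*) [Field K] :
    FreeGradedLie K ℤ →ₗ⁅K⁆ RelativelyFree K :=
  { (tIdealSpan (basicIdentities K)).toSubmodule.mkQ with map_lie' := rfl }

theorem toRelativelyFree_eq_zero {f : FreeGradedLie K ℤ} :
    toRelativelyFree K f = 0 ↔ f ∈ tIdealSpan (basicIdentities K) :=
  Submodule.Quotient.mk_eq_zero _

theorem isTIdeal_identityIdeal_component : IsTIdeal (identityIdeal (U₁.component K)) := by
  apply isTIdeal_identityIdeal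
  intro g h u v hu hv
  exact U₁.lie_mem_component hu hv

theorem isGradedIdentity_of_mem_tIdealSpan {f : FreeGradedLie K ℤ}
    (hf : f ∈ tIdealSpan (basicIdentities K)) : IsGradedIdentity (U₁.component K) f := by
  have h := tIdealSpan_le isTIdeal_identityIdeal_component basicIdentities_subset hf
  exact h

theorem toRelativelyFree_of_mem {f : FreeGradedLie K ℤ}
    (hf : f ∈ tIdealSpan (basicIdentities K)) : toRelativelyFree K f = 0 :=
  toRelativelyFree_eq_zero.2 hf

/-- The images of the homogeneous components in the quotient form a `VirasoroFamily`, so `f` dies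
there. -/
theorem IsGradedIdentity.mem_tIdealSpan [CharZero K] {f : FreeGradedLie K ℤ}
    (hf : IsGradedIdentity (U₁.component K) f) : f ∈ tIdealSpan (basicIdentities K) := by
  have h := hf.map_eq_zero
    (imageFamily (toRelativelyFree K) fun f hf => toRelativelyFree_of_mem hf)
    (toRelativelyFree K) (fun v => Submodule.mem_map.2 ⟨_, x_mem_component v.2 v.1, rfl⟩)
  exact toRelativelyFree_eq_zero.1 h

end FreeGradedLie

theorem theorem1 (K : Type*) [Field K] [CharZero K] :
    FreeGradedLie.IsBasisOfGradedIdentities (U₁.component K)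
      ({f : FreeGradedLie K ℤ | ∃ i : ℤ,
          f = ⁅FreeGradedLie.x K 1 i, FreeGradedLie.x K 2 i⁆} ∪
       {f : FreeGradedLie K ℤ | ∃ a b c : ℤ,
          f = (((c - a) * (b - c - a) : ℤ) : K) •
                ⁅⁅FreeGradedLie.x K 1 a, FreeGradedLie.x K 2 b⁆, FreeGradedLie.x K 3 c⁆ -
              (((b - a) * (c - b - a) : ℤ) : K) •
                ⁅⁅FreeGradedLie.x K 1 a, FreeGradedLie.x K 3 c⁆, FreeGradedLie.x K 2 b⁆}) := by
  intro f
  change f ∈ FreeGradedLie.tIdealSpan (FreeGradedLie.basicIdentities K) ↔ _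
  refine ⟨fun hf => ?_, fun hf => ?_⟩
  · exact FreeGradedLie.isGradedIdentity_of_mem_tIdealSpan hf
  · exact FreeGradedLie.IsGradedIdentity.mem_tIdealSpan hf
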